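/- Consider the rank-six quartic melonic $U(1)$ tensorial group field theory with gauge invariance $\sum_{c} p_c=0$. A Feynman graph $\mathcal G$ has finitely many vertices $v$. Each vertex carries a special colour $c(v)\in\{1,\dots,6\}$ and has two ends, each end bearing one field $\phi$ and one field $\bar\phi$. The bubble of $v$ joins, for every colour $c\neq c(v)$, the $\phi$ and the $\bar\phi$ of the same end, and for $c=c(v)$ the $\phi$ of each end to the $\bar\phi$ of the other end. Lines (colour $0$) join some of the fields $\phi$ to some of the fields $\bar\phi$, each field being in at most one line. In the intermediate-field representation the vertices become wavy lines of colour $c(v)$ with two ends, and the lines become arcs, an arc going from the end that bears its $\phi$ to the end that bears its $\bar\phi$; the cycles of arcs are the loop vertices. A proper intermediate (PI) subgraph $\mathcal H$ is a subgraph whose lines are exactly the arcs of a set of loop vertices of $\mathcal G$, together with all vertices attached to them. Its external lines are the half-lines at its vertices that belong to no line of $\mathcal H$. A wavy line is internal if both its ends lie on loop vertices of $\mathcal H$, and external if exactly one end does. The faces of $\mathcal H$ of colour $c$ are the connected components of the graph formed by the lines of $\mathcal H$ and the bubble edges of colour $c$; a face is internal if it does not end at external half-lines, and otherwise it is open. The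 divergence degree is $\omega(\mathcal H)=-2L(\mathcal H)+F(\mathcal H)-R(\mathcal H)$, where $L$ is the number of lines, $F$ the number of internal faces, and $R$ the rank of the adjacency matrix of lines and internal faces. $\mathcal H$ is superficially divergent if $\omega(\mathcal H)\ge 0$. The degree of a closed coloured graph is the sum of the genera of its jackets, and a graph with external lines is melonic if it is obtained from a closed graph of degree zero by cutting lines of colour $0$. Theorem. Let $\mathcal H$ be a connected PI subgraph which is not a vacuum graph (it has at least one external wavy line). If $\mathcal H$ is superficially divergent, then it is melonic in the ordinary representation and has exactly two or four external lines. Moreover, $\mathcal H$ is superficially divergent if and only if in the intermediate-field representation it is a tree of loop vertices and internal wavy lines which has either (i) exactly one external wavy line, or (ii) exactly two external wavy lines, which have the same colour $c$ and carry the same strand momentum (one open face of colour $c$ runs from the one to the other). In case (i) $\mathcal H$ has two external lines and $\omega(\mathcal H)=2$; in case (ii) it has four external lines and $\omega(\mathcal H)=0$. -/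

import Mathlib

/-! ### Closed bipartite edge-coloured graphs, jackets and degree -/

/-- A closed bipartite edge-coloured graph, regular of valency the number of colours: black nodes `B`,
white nodes `W`, colours `K`; the edge of colour `a` at the black node `x` ends at `edge a x`. -/
structure ColoredGraph (K B W : Type*) where
  edge : K → B ≃ W

namespace ColoredGraph

variable {K B W : Type*}

/-- Two nodes are joined by an edge whose colour lies in `s`. -/
inductive Adj (Γ : ColoredGraph K B W) (s : Set K) : B ⊕ W → B ⊕ W → Prop
  | mk (a : K) (ha : a ∈ s) (x : B) : Adj Γ s (Sum.inl x) (Sum.inr (Γ.edge a x))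

/-- Number of connected components of the subgraph formed by the edges with colours in `s`. -/
noncomputable def numComponents (Γ : ColoredGraph K B W) (s : Set K) : ℕ :=
  Nat.card (Quot (Γ.Adj s))

/-- Genus of the jacket of the cyclic ordering `ξ` of the colours. The jacket is the ribbon graph with
all nodes and edges of the graph, and with the faces (bicoloured components) of two colours
that are consecutive for `ξ`. Its genus is read off from `2 k - 2 g = (nodes) - (edges) + (faces)`,
where `k` is the number of connected components. -/
noncomputable def jacketGenus [Fintype K] (Γ : ColoredGraph K B W) (ξ : Equiv.Perm K) : ℚ :=
  (2 * (Γ.numComponents Set.univ : ℚ)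
    - (((Nat.card B : ℚ) + Nat.card W) - (Fintype.card K : ℚ) * Nat.card B
        + ∑ a : K, (Γ.numComponents {a, ξ a} : ℚ))) / 2

open Classical in
/-- The degree: the sum of the genera of the jackets. Each jacket is given by a cyclic ordering
of all the colours up to orientation, so that it occurs twice in the sum over cyclic orderings. -/
noncomputable def degree [Fintype K] (Γ : ColoredGraph K B W) : ℚ :=
  (∑ ξ ∈ (Finset.univ : Finset (Equiv.Perm K)).filter (fun ξ => ξ.IsCycleOn Set.univ),
    Γ.jacketGenus ξ) / 2

end ColoredGraph

/-! ### Feynman graphs of the quartic melonic model of rank six -/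

/-- A vertex of the quartic model has two ends (the two ends of the wavy line that represents
the vertex in the intermediate field representation). The end `(v, s)` bears one field `φ` and one
field `φ̄`. -/
abbrev HalfWavy (V : Type*) := V × Bool

/-- A Feynman graph of the rank six quartic model with vertex set `V`. The vertex `v` is the bubble
`b_c` with special colour `c = color v`. The Wick contraction `h' ∈ contraction h` is the
line (arc) which joins the field `φ` of the end `h` to the field `φ̄` of the end `h'`; fields without
a contraction are external half-lines of the graph. A line is named by the end `h` that bears
its field `φ`. -/
structure FeynmanGraph (V : Type*) where
  color : V → Fin 6
  contraction : HalfWavy V ≃. HalfWavy V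

namespace FeynmanGraph

variable {V : Type*} (G : FeynmanGraph V)

/-- The edge of colour `c` of a bubble joins the `φ` of the end `h` to the `φ̄` of the end
`G.strand c h`: that of the same end, except for the special colour of the bubble, where it is that
of the opposite end. -/
def strand (c : Fin 6) (h : HalfWavy V) : HalfWavy V :=
  if c = G.color h.1 then (h.1, !h.2) else h

theorem strand_fst (c : Fin 6) (h : HalfWavy V) : (G.strand c h).1 = h.1 := by
  unfold strand; split_ifs <;> rfl

theorem strand_strand (c : Fin 6) (h : HalfWavy V) : G.strand c (G.strand c h) = h := by
  rcases h with ⟨v, s⟩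
  by_cases hc : c = G.color v <;> simp [strand, hc]

/-! #### Subgraphs in the ordinary representation: sets of lines -/

/-- The end `h'` bears the field `φ̄` of a line of `S`. -/
def IsTarget (S : Set (HalfWavy V)) (h' : HalfWavy V) : Prop :=
  ∃ h ∈ S, h' ∈ G.contraction h

/-- The vertices attached to the lines of `S`. -/
def vertices (S : Set (HalfWavy V)) : Set V :=
  {v | ∃ s : Bool, (v, s) ∈ S ∨ G.IsTarget S (v, s)}

/-- Number of external lines of `S`: half-lines (`φ` or `φ̄`) at the vertices of `S` that belong to
no line of `S`. -/
noncomputable def numExternalLines (S : Set (HalfWavy V)) : ℕ :=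
  Nat.card {h : HalfWavy V // h.1 ∈ G.vertices S ∧ h ∉ S} +
    Nat.card {h : HalfWavy V // h.1 ∈ G.vertices S ∧ ¬ G.IsTarget S h}

/-- Nodes of the coloured extension: `Sum.inl h` is the field `φ` and `Sum.inr h` the field
`φ̄` of the end `h`. -/
abbrev Node (V : Type*) := HalfWavy V ⊕ HalfWavy V

/-- Two nodes are joined by a line of `S` (an edge of colour 0) or by a bubble edge of colour `c`. -/
inductive FaceAdj (S : Set (HalfWavy V)) (c : Fin 6) : Node V → Node V → Prop
  | line (h h' : HalfWavy V) (hS : h ∈ S) (hh : h' ∈ G.contraction h) :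
      FaceAdj S c (Sum.inl h) (Sum.inr h')
  | bubble (h : HalfWavy V) : FaceAdj S c (Sum.inl h) (Sum.inr (G.strand c h))

/-- The faces of colour `c`, closed or open: the connected components for the colours 0 and `c`. -/
def Face (S : Set (HalfWavy V)) (c : Fin 6) : Type _ := Quot (G.FaceAdj S c)

/-- The face of colour `c` through a node. -/
def faceAt (S : Set (HalfWavy V)) (c : Fin 6) (x : Node V) : G.Face S c := Quot.mk _ x

/-- The node belongs to a line of `S`. -/
def OnLine (S : Set (HalfWavy V)) : Node V → Prop
  | Sum.inl h => h ∈ S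
  | Sum.inr h => G.IsTarget S h

/-- The internal (closed) faces of `S`, of all colours: those that do not end at a half-line which
belongs to no line of `S`. -/
def InternalFace (S : Set (HalfWavy V)) : Type _ :=
  Σ c : Fin 6, {f : G.Face S c // ∀ x : Node V, G.faceAt S c x = f → G.OnLine S x}

open Classical in
/-- The adjacency matrix of the lines and the internal faces of `S`. Orienting lines and faces
from `φ` to `φ̄` along the lines, all incidences are positive. -/
noncomputable def incidence (S : Set (HalfWavy V)) : Matrix S (G.InternalFace S) ℚ :=
  fun l f => if G.faceAt S f.1 (Sum.inl l.1) = f.2.1 then 1 else 0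

/-- The rank `R` of the adjacency matrix (the dimension of its row space). -/
noncomputable def incidenceRank (S : Set (HalfWavy V)) : ℕ :=
  Module.finrank ℚ (Submodule.span ℚ (Set.range (G.incidence S)))

/-- The divergence degree `ω = -2 L + F - R`. -/
noncomputable def divergenceDegree (S : Set (HalfWavy V)) : ℤ :=
  -2 * (Nat.card S : ℤ) + (Nat.card (G.InternalFace S) : ℤ) - (G.incidenceRank S : ℤ)

/-- The half wavy lines at the vertices of `S`. -/
abbrev Ends (S : Set (HalfWavy V)) := {h : HalfWavy V // h.1 ∈ G.vertices S}

/-- The bubble edges of colour `c` at the vertices of `S`. -/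
def bubbleEquiv (S : Set (HalfWavy V)) (c : Fin 6) : G.Ends S ≃ G.Ends S where
  toFun h := ⟨G.strand c h.1, by rw [strand_fst]; exact h.2⟩
  invFun h := ⟨G.strand c h.1, by rw [strand_fst]; exact h.2⟩
  left_inv h := Subtype.ext (G.strand_strand c h.1)
  right_inv h := Subtype.ext (G.strand_strand c h.1)

/-- The closed coloured graph (seven colours, `none` being the colour 0) on the vertices of `S` with
the lines `e`. -/
def closedGraph (S : Set (HalfWavy V)) (e : G.Ends S ≃ G.Ends S) :
    ColoredGraph (Option (Fin 6)) (G.Ends S) (G.Ends S) where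
  edge a := a.elim e (G.bubbleEquiv S)

/-- `S` is melonic in the ordinary representation: it is obtained from a closed graph of degree
zero by cutting lines (of colour 0) into pairs of external half-lines. -/
def IsMelonic (S : Set (HalfWavy V)) : Prop :=
  ∃ e : G.Ends S ≃ G.Ends S,
    (∀ h : G.Ends S, h.1 ∈ S → (e h).1 ∈ G.contraction h.1) ∧ (G.closedGraph S e).degree = 0

/-! #### The intermediate field representation -/

/-- `h'` follows `h` on the boundary of a disk: there is an arc from `h` to `h'`. -/
def Next (h h' : HalfWavy V) : Prop := h' ∈ G.contraction h

/-- The loop vertices (cycles of arcs), each given as the set of its half wavy lines, equivalently of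
its arcs. The chains (ciliated vertices) are the sequences of arcs that do not close. -/
def loopVertices : Set (Set (HalfWavy V)) :=
  {A | ∃ h, Relation.TransGen G.Next h h ∧ A = {h' | Relation.TransGen G.Next h h'}}

/-- A proper intermediate (PI) subgraph: its arcs are exactly those of a set of loop vertices. -/
structure PISubgraph where
  loops : Set (Set (HalfWavy V))
  loops_subset : loops ⊆ G.loopVertices

namespace PISubgraph

variable {G} (H : G.PISubgraph)

/-- The lines (arcs) of the subgraph. -/
def lines : Set (HalfWavy V) := ⋃₀ H.loops

/-- The wavy line `v` joins the loop vertices `A` and `B`. -/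
def Joins (v : V) (A B : H.loops) : Prop :=
  ((v, false) ∈ A.1 ∧ (v, true) ∈ B.1) ∨ ((v, true) ∈ A.1 ∧ (v, false) ∈ B.1)

/-- The graph of the loop vertices of `H`, joined by the internal wavy lines of `H`, with
multiplicities and self-loops forgotten. -/
def simpleGraph : SimpleGraph H.loops where
  Adj A B := A ≠ B ∧ ∃ v, H.Joins v A B
  symm := ⟨fun _ _ h => ⟨h.1.symm, h.2.imp fun _ hv => hv.symm.imp And.symm And.symm⟩⟩
  loopless := ⟨fun _ h => h.1 rfl⟩

/-- `H` is connected (in particular it has a loop vertex). -/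
def Connected : Prop := H.simpleGraph.Connected

/-- `H` is a tree of loop vertices and wavy lines: no self-loop, no pair of wavy lines between the
same loop vertices, and the underlying simple graph is a tree. -/
def IsTree : Prop :=
  H.simpleGraph.IsTree ∧
    (∀ v A, ¬ H.Joins v A A) ∧
    (∀ v w A B, H.Joins v A B → H.Joins w A B → v = w)

/-- The external wavy lines of `H`, each given by its end on `H`: wavy lines with only one end
on a loop vertex of `H`. -/
def externalWavy : Set (HalfWavy V) :=
  {h | h ∈ H.lines ∧ (h.1, !h.2) ∉ H.lines}

/-- The number of external wavy lines. -/
noncomputable def numExternalWavy : ℕ := Nat.card H.externalWavy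

/-- The external wavy lines `h` and `h'` have the same colour `c` and carry the same strand momentum:
one open face of colour `c` of the subgraph runs from the one to the other. -/
def SameStrand (h h' : HalfWavy V) : Prop :=
  G.color h.1 = G.color h'.1 ∧
    (G.faceAt H.lines (G.color h.1) (Sum.inl h) = G.faceAt H.lines (G.color h.1) (Sum.inr h') ∨
     G.faceAt H.lines (G.color h.1) (Sum.inl h') = G.faceAt H.lines (G.color h.1) (Sum.inr h))

/-- Exactly two external wavy lines, of the same colour and with the same strand momentum. -/
def HasMonocolorPair : Prop :=
  H.numExternalWavy = 2 ∧
    ∃ h ∈ H.externalWavy, ∃ h' ∈ H.externalWavy, h ≠ h' ∧ H.SameStrand h h'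

/-- The divergence degree of the PI subgraph. -/
noncomputable def omega : ℤ := G.divergenceDegree H.lines

end PISubgraph

end FeynmanGraph

/-!
A vector in the kernel of the incidence matrix is a function on the internal faces, extended by
zero to the open ones, whose sum over the six faces through each line vanishes. Consecutive arcs
of a loop vertex share the faces of five colours, so that the values at the sixth colour agree as
well. Hence the kernel is the space of functions `u c A` of a colour and a loop vertex which sum
to zero over `c`, agree for the colour of a wavy line at its two ends, and vanish for its colour
at an external wavy line; and `ω` is its dimension minus four times the number of internal wavy
lines and twice the number of external ones.

Root `H` at a loop vertex with an external wavy line. Each loop vertex costs two dimensions, one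
for the sum and one for the wavy line towards the root, so the dimension is at most four times the
number of loop vertices, and `ω ≤ 4 - 2 E` for `E` external wavy lines, with equality only on a
tree. So `ω ≥ 0` forces a tree with `E ≤ 2`, and for `E = 2` the constraint of the second external
wavy line has to follow from the others. It does so only through a path of wavy lines of its own
colour from the first.

A function on the faces of colour `c` takes values at the fields `φ` and at the fields `φ̄`. The
difference of the two is a conserved flow along the wavy lines, and on a tree such a flow
vanishes. This turns the path of wavy lines into an open face, and it counts the bicoloured
components of the closure of a tree: those of the colours `a ≠ b` number `w a + w b` for a
function `w`, whence every jacket has the same number of faces, and its genus is zero.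
-/

open Relation in
theorem transGen_symm_of_transGen_self {α : Type*} {r : α → α → Prop} (hr : Relator.RightUnique r)
    {a b : α} (ha : TransGen r a a) (hab : TransGen r a b) : TransGen r b a := by
  have advance {c d : α} (hc : TransGen r c a) (hcd : r c d) : TransGen r d a := by
    obtain ⟨d', hcd', hd'⟩ := TransGen.head'_iff.1 hc
    obtain rfl := hr hcd hcd'
    exact TransGen.trans_right hd' ha
  induction hab with
  | single h => exact advance ha h
  | tail _ h ih => exact advance ih h

section EdgeDifferences

variable (𝕜 : Type*) [Field 𝕜] {Λ N : Type*}

/-- The differences of a function on `Λ` along the edges of the graph with edges `v : N` joining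
`s v` to `t v`: the transpose of the signed incidence matrix of that graph. -/
def edgeDiff (s t : N → Λ) : (Λ → 𝕜) →ₗ[𝕜] (N → 𝕜) :=
  LinearMap.funLeft 𝕜 𝕜 s - LinearMap.funLeft 𝕜 𝕜 t

variable {𝕜} {s t : N → Λ}

theorem edgeDiff_apply (u : Λ → 𝕜) (v : N) : edgeDiff 𝕜 s t u v = u (s v) - u (t v) := rfl

theorem edgeDiff_surjective [Finite Λ] [Finite N]
    (hconn : ∀ u : Λ → 𝕜, (∀ v, u (s v) = u (t v)) → ∀ A B, u A = u B)
    (hcard : Nat.card Λ = Nat.card N + 1) : Function.Surjective (edgeDiff 𝕜 s t) := by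
  have := Fintype.ofFinite Λ
  have := Fintype.ofFinite N
  obtain ⟨A⟩ : Nonempty Λ := Finite.card_pos_iff.1 (by omega)
  have hker : Module.finrank 𝕜 (edgeDiff 𝕜 s t).ker ≤ 1 := by
    let eval : (edgeDiff 𝕜 s t).ker →ₗ[𝕜] 𝕜 := LinearMap.proj A ∘ₗ Submodule.subtype _
    have heval : Function.Injective eval := by
      refine (injective_iff_map_eq_zero eval).2 fun u hu => Subtype.ext (funext fun B => ?_)
      exact (hconn u.1 (fun v => sub_eq_zero.1 (congrFun u.2 v)) B A).trans hu
    simpa using LinearMap.finrank_le_finrank_of_injective heval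
  have hrank := (edgeDiff 𝕜 s t).finrank_range_add_finrank_ker
  rw [Module.finrank_fintype_fun_eq_card, ← Nat.card_eq_fintype_card, hcard] at hrank
  rw [← LinearMap.range_eq_top]
  refine Submodule.eq_top_of_finrank_eq (le_antisymm (Submodule.finrank_le _) ?_)
  rw [Module.finrank_fintype_fun_eq_card, ← Nat.card_eq_fintype_card]
  omega

theorem card_quot_add_card_of_surjective_edgeDiff [Finite Λ] [Finite N]
    (hs : Function.Surjective (edgeDiff 𝕜 s t)) (P : N → Prop) :
    Nat.card (Quot fun A B => ∃ v, P v ∧ A = s v ∧ B = t v) + Nat.card {v // P v} =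
      Nat.card Λ := by
  set r : Λ → Λ → Prop := fun A B => ∃ v, P v ∧ A = s v ∧ B = t v
  have := Fintype.ofFinite Λ
  have := Fintype.ofFinite {v // P v}
  have := Fintype.ofFinite (Quot r)
  let restrict := LinearMap.funLeft 𝕜 𝕜 (Subtype.val : {v // P v} → N) ∘ₗ edgeDiff 𝕜 s t
  have hrestrict : Function.Surjective restrict :=
    (LinearMap.funLeft_surjective_of_injective 𝕜 𝕜 _ Subtype.val_injective).comp hs
  have hpull : Function.Injective (LinearMap.funLeft 𝕜 𝕜 (Quot.mk r)) :=
    LinearMap.funLeft_injective_of_surjective 𝕜 𝕜 _ Quot.mk_surjective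
  have hker : (LinearMap.funLeft 𝕜 𝕜 (Quot.mk r)).range = restrict.ker := by
    ext u
    constructor
    · rintro ⟨w, rfl⟩
      exact funext fun v => sub_eq_zero.2 (congrArg w (Quot.sound ⟨v.1, v.2, rfl, rfl⟩))
    · refine fun hu => ⟨Quot.lift u ?_, rfl⟩
      rintro _ _ ⟨v, hv, rfl, rfl⟩
      exact sub_eq_zero.1 (congrFun hu ⟨v, hv⟩)
  have hrank := restrict.finrank_range_add_finrank_ker
  rw [LinearMap.range_eq_top.2 hrestrict, finrank_top, ← hker, LinearMap.finrank_range_of_inj hpull]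
    at hrank
  simp only [Module.finrank_fintype_fun_eq_card, ← Nat.card_eq_fintype_card] at hrank
  omega

/-- The function `a` is the flow that leaves each dart and `b` the flow that enters it. The net
flow through an edge is orthogonal to the differences along the edges, which on a tree span
everything. -/
theorem eq_of_conserved_on_edges [Finite N] {D : Type*} (e : N × Bool ≃ D) (σ : Equiv.Perm D)
    {ℓ : D → Λ} (hℓ : ∀ d, ℓ (σ d) = ℓ d)
    (hs : Function.Surjective (edgeDiff 𝕜 (fun v => ℓ (e (v, true))) fun v => ℓ (e (v, false))))
    {a b : D → 𝕜} (hσ : ∀ d, b (σ d) = a d)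
    (hab : ∀ v, ∑ i, a (e (v, i)) = ∑ i, b (e (v, i))) : a = b := by
  have := Fintype.ofFinite N
  have := Fintype.ofEquiv _ e
  have hfalse (v : N) : a (e (v, false)) - b (e (v, false)) =
      -(a (e (v, true)) - b (e (v, true))) := by
    have := hab v
    simp only [Fintype.sum_bool] at this
    linear_combination this
  have horth (u : Λ → 𝕜) : ∑ d, (a d - b d) * u (ℓ d) = 0 := by
    simp only [sub_mul, Finset.sum_sub_distrib, sub_eq_zero]
    rw [← Equiv.sum_comp σ fun d => b d * u (ℓ d)]
    simp only [hσ, hℓ]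
  have hzero : (fun v => a (e (v, true)) - b (e (v, true))) = 0 := by
    refine dotProduct_eq_zero _ fun w => ?_
    obtain ⟨u, rfl⟩ := hs w
    rw [← horth u, ← e.sum_comp, Fintype.sum_prod_type]
    refine Finset.sum_congr rfl fun v _ => ?_
    rw [Fintype.sum_bool, hfalse, edgeDiff_apply]
    ring
  funext d
  obtain ⟨⟨v, _ | _⟩, rfl⟩ := e.surjective d
  · rw [← sub_eq_zero, hfalse, congrFun hzero v, Pi.zero_apply, neg_zero]
  · exact sub_eq_zero.1 (congrFun hzero v)

end EdgeDifferences

/-- Besides the entries in `D A`, one further entry at `A` is determined by the vanishing sum. -/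
theorem finrank_add_sum_card_le {𝕜 K Λ : Type*} [Field 𝕜] [Fintype K] [Fintype Λ]
    {W : Submodule 𝕜 (K → Λ → 𝕜)} (hsum : ∀ u ∈ W, ∀ A, ∑ c, u c A = 0)
    (r : Λ → ℕ) (D : Λ → Finset K) (hcard : ∀ A, (D A).card < Fintype.card K)
    (hD : ∀ u ∈ W, ∀ A, (∀ B, r B < r A → ∀ c, u c B = 0) → ∀ c ∈ D A, u c A = 0) :
    Module.finrank 𝕜 W + ∑ A, ((D A).card + 1) ≤ Fintype.card K * Fintype.card Λ := by
  classical
  have hexists (A : Λ) : ∃ c, c ∉ D A := by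
    by_contra! h
    exact (hcard A).ne (by rw [Finset.eq_univ_of_forall h, Finset.card_univ])
  choose c₀ hc₀ using hexists
  let restrict : W →ₗ[𝕜] ((Σ A, ↥(insert (c₀ A) (D A))ᶜ) → 𝕜) :=
    LinearMap.pi fun p => LinearMap.proj p.1 ∘ₗ LinearMap.proj p.2.1 ∘ₗ W.subtype
  have hinj : Function.Injective restrict := by
    refine (injective_iff_map_eq_zero restrict).2 fun u hu => Subtype.ext ?_
    suffices ∀ n A, r A = n → ∀ c, u.1 c A = 0 from funext₂ fun c A => this _ A rfl c
    intro n
    induction n using Nat.strong_induction_on with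
    | _ n ih =>
      rintro A rfl
      have hne (c : K) (hc : c ≠ c₀ A) : u.1 c A = 0 := by
        by_cases hcD : c ∈ D A
        · exact hD u u.2 A (fun B hB => ih _ hB B rfl) c hcD
        · exact congrFun hu ⟨A, c, by simp [hc, hcD]⟩
      intro c
      obtain rfl | hc := eq_or_ne c (c₀ A)
      · rw [← hsum u u.2 A, Finset.sum_eq_single (c₀ A) (fun b _ => hne b) (by simp)]
      · exact hne c hc
  have hrank := LinearMap.finrank_le_finrank_of_injective hinj
  simp only [Module.finrank_fintype_fun_eq_card, Fintype.card_sigma, Fintype.card_coe] at hrank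
  calc Module.finrank 𝕜 W + ∑ A, ((D A).card + 1)
      ≤ ∑ A, (((insert (c₀ A) (D A))ᶜ).card + (insert (c₀ A) (D A)).card) := by
        simpa only [Finset.sum_add_distrib, Finset.card_insert_of_notMem (hc₀ _)] using by gcongr
    _ = Fintype.card K * Fintype.card Λ := by
        simp only [Finset.card_compl_add_card, Finset.sum_const, Finset.card_univ, smul_eq_mul,
          mul_comm]

theorem extend_zero_apply_eq_sum {α β M : Type*} [Fintype α] [DecidableEq β] [AddCommMonoid M]
    {e : α → β} (he : Function.Injective e) (y : α → M) (b : β) :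
    Function.extend e y 0 b = ∑ a, if e a = b then y a else 0 := by
  by_cases hb : ∃ a, e a = b
  · obtain ⟨a, rfl⟩ := hb
    classical simp [he.extend_apply, he.eq_iff]
  · rw [Function.extend_apply' _ _ _ hb]
    exact (Finset.sum_eq_zero fun a _ => if_neg fun h => hb ⟨a, h⟩).symm

section Multigraphs

variable {N X : Type*}

theorem exists_adj_dist_lt {Γ : SimpleGraph X} (hΓ : Γ.Connected) {x y : X} (hxy : x ≠ y) :
    ∃ z, Γ.Adj x z ∧ Γ.dist z y < Γ.dist x y := by
  obtain ⟨p, hp⟩ := hΓ.exists_walk_length_eq_dist x y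
  cases p with
  | nil => exact absurd rfl hxy
  | cons hadj q => exact ⟨_, hadj, hp ▸ Nat.lt_succ_of_le (SimpleGraph.dist_le q)⟩

open SimpleGraph (fromEdgeSet)

theorem card_edgeSet_fromEdgeSet_range_le [Finite N] (f : N → Sym2 X) :
    Nat.card (fromEdgeSet (Set.range f)).edgeSet ≤ Nat.card N := by
  rw [Nat.card_coe_set_eq, SimpleGraph.edgeSet_fromEdgeSet]
  exact (Set.ncard_le_ncard Set.sdiff_subset (Set.finite_range f)).trans
    (Nat.card_coe_set_eq (Set.range f) ▸ Finite.card_range_le f)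

theorem card_edgeSet_fromEdgeSet_range_eq_iff [Finite N] {f : N → Sym2 X} :
    Nat.card (fromEdgeSet (Set.range f)).edgeSet = Nat.card N ↔
      Function.Injective f ∧ ∀ v, ¬ (f v).IsDiag := by
  rw [Nat.card_coe_set_eq, SimpleGraph.edgeSet_fromEdgeSet]
  have hrange : (Set.range f).ncard ≤ Nat.card N :=
    Nat.card_coe_set_eq (Set.range f) ▸ Finite.card_range_le f
  constructor
  · intro h
    have hdiff : Set.range f \ Sym2.diagSet = Set.range f :=
      Set.eq_of_subset_of_ncard_le Set.sdiff_subset (h ▸ hrange) (Set.finite_range f)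
    constructor
    · rw [← Set.injOn_univ]
      refine Set.injOn_of_ncard_image_eq ?_
      rw [Set.image_univ, Set.ncard_univ, ← h, hdiff]
    · exact fun v => (hdiff.ge (Set.mem_range_self v)).2
  · rintro ⟨hinj, hdiag⟩
    rw [sdiff_eq_left.2, Set.ncard_range_of_injective hinj]
    exact Set.disjoint_left.2 fun _ ⟨v, hv⟩ hd => hdiag v (by simpa [hv] using hd)

theorem card_le_of_connected_fromEdgeSet_range [Finite N] {f : N → Sym2 X}
    (hc : (fromEdgeSet (Set.range f)).Connected) : Nat.card X ≤ Nat.card N + 1 :=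
  hc.card_vert_le_card_edgeSet_add_one.trans
    (Nat.succ_le_succ (card_edgeSet_fromEdgeSet_range_le f))

theorem isTree_fromEdgeSet_range_iff [Finite N] [Finite X] {f : N → Sym2 X} :
    (fromEdgeSet (Set.range f)).IsTree ∧ Function.Injective f ∧ (∀ v, ¬ (f v).IsDiag) ↔
      (fromEdgeSet (Set.range f)).Connected ∧ Nat.card N + 1 = Nat.card X := by
  rw [← card_edgeSet_fromEdgeSet_range_eq_iff, SimpleGraph.isTree_iff_connected_and_card]
  have hle := card_edgeSet_fromEdgeSet_range_le f
  constructor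
  · rintro ⟨⟨hc, hX⟩, hN⟩
    exact ⟨hc, hN ▸ hX⟩
  · rintro ⟨hc, hX⟩
    have hge := hc.card_vert_le_card_edgeSet_add_one
    exact ⟨⟨hc, by omega⟩, by omega⟩

end Multigraphs

namespace ColoredGraph

/-- `ℓ` labels the components of what remains without the edges between `p v` and `q v`. -/
theorem numComponents_eq_card_quot {K N X Λ : Type*} {Γ : ColoredGraph K X X} {s : Set K}
    (hside : ∀ x, Quot.mk (Γ.Adj s) (Sum.inl x) = Quot.mk _ (Sum.inr x)) {ℓ : X → Λ}
    (hℓ : Function.Surjective ℓ)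
    (hlabel : ∀ x y, ℓ x = ℓ y → Quot.mk (Γ.Adj s) (Sum.inl x) = Quot.mk _ (Sum.inl y))
    {P : N → Prop} {p q : N → X}
    (hjoin : ∀ v, P v → Quot.mk (Γ.Adj s) (Sum.inl (p v)) = Quot.mk _ (Sum.inl (q v)))
    (hedge : ∀ a ∈ s, ∀ x, ℓ (Γ.edge a x) = ℓ x ∨
      ∃ v, P v ∧ (x = p v ∧ Γ.edge a x = q v ∨ x = q v ∧ Γ.edge a x = p v)) :
    Γ.numComponents s = Nat.card (Quot fun A B => ∃ v, P v ∧ A = ℓ (p v) ∧ B = ℓ (q v)) := by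
  set r : Λ → Λ → Prop := fun A B => ∃ v, P v ∧ A = ℓ (p v) ∧ B = ℓ (q v)
  let component : X ⊕ X → Quot r := Sum.elim (fun x => Quot.mk r (ℓ x)) fun x => Quot.mk r (ℓ x)
  have hrep (x : X) : Quot.mk (Γ.Adj s) (Sum.inl (Function.surjInv hℓ (ℓ x))) =
      Quot.mk _ (Sum.inl x) :=
    hlabel _ _ (Function.surjInv_eq hℓ _)
  refine Nat.card_congr ⟨Quot.lift component ?_,
    Quot.lift (fun A => Quot.mk _ (Sum.inl (Function.surjInv hℓ A))) ?_, ?_, ?_⟩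
  · rintro _ _ ⟨a, ha, x⟩
    rcases hedge a ha x with hx | ⟨v, hv, ⟨hx, hy⟩ | ⟨hx, hy⟩⟩
    · exact congrArg (Quot.mk r) hx.symm
    · exact Quot.sound ⟨v, hv, congrArg ℓ hx, congrArg ℓ hy⟩
    · exact (Quot.sound ⟨v, hv, congrArg ℓ hy, congrArg ℓ hx⟩).symm
  · rintro _ _ ⟨v, hv, rfl, rfl⟩
    rw [hrep, hrep, hjoin v hv]
  · rintro ⟨x | x⟩
    · exact hrep x
    · exact (hrep x).trans (hside x)
  · rintro ⟨A⟩
    exact congrArg (Quot.mk r) (Function.surjInv_eq hℓ A)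

variable {K B W : Type*} [Fintype K] {Γ : ColoredGraph K B W}

theorem jacketGenus_eq_zero {w : K → ℚ}
    (hfaces : ∀ a b, a ≠ b → (Γ.numComponents {a, b} : ℚ) = w a + w b)
    (heuler : 2 * (Γ.numComponents Set.univ : ℚ) =
      Nat.card B + Nat.card W - Fintype.card K * Nat.card B + 2 * ∑ a, w a)
    {ξ : Equiv.Perm K} (hξ : ∀ a, ξ a ≠ a) : Γ.jacketGenus ξ = 0 := by
  have hsum : ∑ a, (Γ.numComponents {a, ξ a} : ℚ) = 2 * ∑ a, w a := by
    rw [Finset.sum_congr rfl fun a _ => hfaces a (ξ a) (hξ a).symm, Finset.sum_add_distrib,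
      Equiv.sum_comp ξ w, two_mul]
  rw [jacketGenus, hsum, heuler, sub_self, zero_div]

theorem degree_eq_zero [Nontrivial K] {w : K → ℚ}
    (hfaces : ∀ a b, a ≠ b → (Γ.numComponents {a, b} : ℚ) = w a + w b)
    (heuler : 2 * (Γ.numComponents Set.univ : ℚ) =
      Nat.card B + Nat.card W - Fintype.card K * Nat.card B + 2 * ∑ a, w a) :
    Γ.degree = 0 := by
  rw [degree, Finset.sum_eq_zero, zero_div]
  intro ξ hξ
  classical
  have hcycle := (Finset.mem_filter.1 hξ).2
  exact jacketGenus_eq_zero hfaces heuler fun a =>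
    hcycle.apply_ne Set.nontrivial_univ (Set.mem_univ a)

end ColoredGraph

namespace FeynmanGraph

open Relation

variable {V : Type*} {G : FeynmanGraph V} {S : Set (HalfWavy V)}

theorem next_rightUnique : Relator.RightUnique G.Next := fun _ _ _ => Option.mem_unique

theorem next_leftUnique : Relator.LeftUnique G.Next := fun _ _ _ => G.contraction.inj

theorem strand_of_ne {c : Fin 6} {h : HalfWavy V} (hc : c ≠ G.color h.1) : G.strand c h = h :=
  if_neg hc

theorem strand_color (h : HalfWavy V) : G.strand (G.color h.1) h = (h.1, !h.2) := if_pos rfl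

variable (G S) in
/-- The two ends of each vertex. -/
def endsEquiv : G.vertices S × Bool ≃ G.Ends S where
  toFun p := ⟨(p.1.1, p.2), p.1.2⟩
  invFun h := (⟨h.1.1, h.2⟩, h.1.2)

section Faces

theorem faceAt_line {h h' : HalfWavy V} (c : Fin 6) (hS : h ∈ S) (hn : G.Next h h') :
    G.faceAt S c (Sum.inl h) = G.faceAt S c (Sum.inr h') :=
  Quot.sound (.line h h' hS hn)

theorem faceAt_strand (c : Fin 6) (h : HalfWavy V) :
    G.faceAt S c (Sum.inl h) = G.faceAt S c (Sum.inr (G.strand c h)) :=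
  Quot.sound (.bubble h)

theorem faceAt_inr (c : Fin 6) (h : HalfWavy V) :
    G.faceAt S c (Sum.inr h) = G.faceAt S c (Sum.inl (G.strand c h)) := by
  rw [faceAt_strand, strand_strand]

/-- A function on the ends that is constant along the lines of `S` and the strands of colour `c`,
seen as a function on the faces of colour `c`. -/
def liftFace {α : Type*} (g : HalfWavy V → α) (c : Fin 6)
    (hline : ∀ h ∈ S, ∀ h', G.Next h h' → g h = g h') (hstrand : ∀ h, g (G.strand c h) = g h) :
    G.Face S c → α :=
  Quot.lift (Sum.elim g g) <| by
    rintro _ _ (⟨h, h', hS, hn⟩ | h)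
    · exact hline h hS h' hn
    · exact (hstrand h).symm

instance [Finite V] (c : Fin 6) : Finite (G.Face S c) :=
  inferInstanceAs (Finite (Quot (G.FaceAdj S c)))

/-- An internal face as one of all faces. -/
def toFace (f : G.InternalFace S) : Σ c, G.Face S c := ⟨f.1, f.2.1⟩

theorem toFace_injective : Function.Injective (toFace : G.InternalFace S → _) :=
  Function.injective_id.sigma_map fun _ => Subtype.val_injective

instance [Finite V] : Finite (G.InternalFace S) := Finite.of_injective toFace toFace_injective

noncomputable instance [Finite V] : Fintype (G.InternalFace S) := Fintype.ofFinite _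

theorem mem_range_toFace {c : Fin 6} {f : G.Face S c} :
    ⟨c, f⟩ ∈ Set.range (toFace : G.InternalFace S → _) ↔
      ∀ x, G.faceAt S c x = f → G.OnLine S x := by
  constructor
  · rintro ⟨⟨c', f'⟩, hf⟩
    cases hf
    exact f'.2
  · exact fun hf => ⟨⟨c, f, hf⟩, rfl⟩

/-- The extension by zero to the open faces of a function on the internal faces. -/
noncomputable def extendZero : (G.InternalFace S → ℚ) →ₗ[ℚ] ((Σ c, G.Face S c) → ℚ) :=
  Function.ExtendByZero.linearMap ℚ toFace

theorem extendZero_toFace (y : G.InternalFace S → ℚ) (f : G.InternalFace S) :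
    extendZero y (toFace f) = y f :=
  toFace_injective.extend_apply y 0 f

theorem extendZero_of_not_onLine (y : G.InternalFace S → ℚ) (c : Fin 6) {x : Node V}
    (hx : ¬ G.OnLine S x) : extendZero y ⟨c, G.faceAt S c x⟩ = 0 :=
  Function.extend_apply' _ _ _ fun hf => hx (mem_range_toFace.1 hf x rfl)

theorem extendZero_comp_toFace {g : (Σ c, G.Face S c) → ℚ}
    (hg : ∀ c x, ¬ G.OnLine S x → g ⟨c, G.faceAt S c x⟩ = 0) : extendZero (g ∘ toFace) = g := by
  funext ⟨c, f⟩
  by_cases hf : ⟨c, f⟩ ∈ Set.range (toFace : G.InternalFace S → _)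
  · obtain ⟨f', hf'⟩ := hf
    rw [← hf', extendZero_toFace, Function.comp_apply]
  · have hopen := mt mem_range_toFace.2 hf
    push Not at hopen
    obtain ⟨x, rfl, hx⟩ := hopen
    rw [extendZero_of_not_onLine _ c hx, hg c x hx]

theorem incidence_mulVecLin_apply [Finite V] (y : G.InternalFace S → ℚ) (l : S) :
    (G.incidence S).mulVecLin y l = ∑ c, extendZero y ⟨c, G.faceAt S c (Sum.inl l)⟩ := by
  classical
  have hextend (c : Fin 6) : extendZero y ⟨c, G.faceAt S c (Sum.inl l)⟩ =
      ∑ f, if toFace f = ⟨c, G.faceAt S c (Sum.inl l)⟩ then y f else 0 :=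
    extend_zero_apply_eq_sum toFace_injective y _
  simp only [hextend]
  rw [Matrix.mulVecLin_apply, Matrix.mulVec, dotProduct, Finset.sum_comm]
  refine Finset.sum_congr rfl fun ⟨c, f⟩ _ => ?_
  rw [Finset.sum_eq_single c (fun c' _ hc => if_neg fun h => hc (congrArg Sigma.fst h).symm)
    (by simp)]
  simp [incidence, toFace, eq_comm]

theorem divergenceDegree_eq [Finite V] :
    G.divergenceDegree S =
      -2 * (Nat.card S : ℤ) + Module.finrank ℚ (G.incidence S).mulVecLin.ker := by
  have hrank : G.incidenceRank S = Module.finrank ℚ (G.incidence S).mulVecLin.range :=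
    (G.incidence S).rank_eq_finrank_span_row.symm
  have hker := (G.incidence S).mulVecLin.finrank_range_add_finrank_ker
  rw [Module.finrank_fintype_fun_eq_card, ← Nat.card_eq_fintype_card] at hker
  rw [divergenceDegree, hrank]
  omega

end Faces

namespace PISubgraph

variable {H : G.PISubgraph} {A A₀ B : H.loops} {h h' h₀ : HalfWavy V} {c c' : Fin 6} {α : Type*}

section Loops

theorem mem_loop_iff_transGen (hA : h ∈ A.1) : h' ∈ A.1 ↔ TransGen G.Next h h' := by
  obtain ⟨k, hk, hAk⟩ := H.loops_subset A.2
  rw [hAk] at hA ⊢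
  exact ⟨(transGen_symm_of_transGen_self next_rightUnique hk hA).trans, TransGen.trans hA⟩

theorem loop_nonempty (A : H.loops) : A.1.Nonempty := by
  obtain ⟨k, hk, hA⟩ := H.loops_subset A.2
  exact ⟨k, hA ▸ hk⟩

theorem loop_unique (hA : h ∈ A.1) (hB : h ∈ B.1) : A = B :=
  Subtype.ext (Set.ext fun _ => (mem_loop_iff_transGen hA).trans (mem_loop_iff_transGen hB).symm)

theorem mem_lines_of_mem_loop (hA : h ∈ A.1) : h ∈ H.lines := ⟨A.1, A.2, hA⟩

theorem mem_loop_iff_of_next (hn : G.Next h h') : h ∈ A.1 ↔ h' ∈ A.1 := by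
  constructor <;> intro hA
  · exact (mem_loop_iff_transGen hA).2 (.single hn)
  · have hcycle := (mem_loop_iff_transGen hA).1 hA
    obtain ⟨k, hk, hkn⟩ := TransGen.tail'_iff.1 hcycle
    obtain rfl := next_leftUnique hn hkn
    exact (mem_loop_iff_transGen hA).2 (hcycle.trans_left hk)

variable (H) in
/-- The loop vertex that bears an end of `H`. -/
noncomputable def loopOf (h : H.lines) : H.loops := ⟨h.2.choose, h.2.choose_spec.1⟩

theorem mem_loopOf (h : H.lines) : h.1 ∈ (H.loopOf h).1 := h.2.choose_spec.2

theorem loopOf_eq (hA : h ∈ A.1) : H.loopOf ⟨h, mem_lines_of_mem_loop hA⟩ = A :=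
  loop_unique (mem_loopOf ⟨h, _⟩) hA

theorem loopOf_surjective : Function.Surjective H.loopOf := fun A =>
  have ⟨_, hA⟩ := loop_nonempty A
  ⟨_, loopOf_eq hA⟩

theorem mem_lines_iff_of_next (hn : G.Next h h') : h ∈ H.lines ↔ h' ∈ H.lines :=
  exists_congr fun A => and_congr_right fun hA => mem_loop_iff_of_next (A := ⟨A, hA⟩) hn

theorem exists_next (h : H.lines) : ∃ h' : H.lines, G.Next h h' := by
  have hcycle := (mem_loop_iff_transGen (mem_loopOf h)).1 (mem_loopOf h)
  obtain ⟨k, hn, -⟩ := TransGen.head'_iff.1 hcycle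
  exact ⟨⟨k, (mem_lines_iff_of_next hn).1 h.2⟩, hn⟩

theorem exists_prev (h : H.lines) : ∃ h' : H.lines, G.Next h' h := by
  have hcycle := (mem_loop_iff_transGen (mem_loopOf h)).1 (mem_loopOf h)
  obtain ⟨k, -, hn⟩ := TransGen.tail'_iff.1 hcycle
  exact ⟨⟨k, (mem_lines_iff_of_next hn).2 h.2⟩, hn⟩

variable (H) in
/-- The permutation of the ends on `H` that follows the arcs of `H`. -/
noncomputable def next : Equiv.Perm H.lines :=
  Equiv.ofBijective (fun h => (exists_next h).choose) <| by
    have hnext (h : H.lines) : G.Next h (exists_next h).choose := (exists_next h).choose_spec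
    refine ⟨fun h k hhk => Subtype.ext (next_leftUnique (hnext h) ?_), fun h => ?_⟩
    · exact (congrArg (fun x : H.lines => G.Next k x) hhk).mpr (hnext k)
    · obtain ⟨k, hk⟩ := exists_prev h
      exact ⟨k, Subtype.ext (next_rightUnique (hnext k) hk)⟩

theorem next_spec (h : H.lines) : G.Next h (H.next h) := (exists_next h).choose_spec

theorem next_eq (hn : G.Next h h') (hh : h ∈ H.lines) :
    H.next ⟨h, hh⟩ = ⟨h', (mem_lines_iff_of_next hn).1 hh⟩ :=
  Subtype.ext (next_rightUnique (next_spec ⟨h, hh⟩) hn)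

theorem loopOf_next (h : H.lines) : H.loopOf (H.next h) = H.loopOf h :=
  loop_unique (mem_loopOf _) ((mem_loop_iff_of_next (next_spec h)).1 (mem_loopOf h))

theorem eq_of_loopOf_eq {α : Type*} {f : H.lines → α} (hf : ∀ h, f (H.next h) = f h)
    {h h' : H.lines} (hh : H.loopOf h = H.loopOf h') : f h = f h' := by
  obtain ⟨k, hk⟩ := h'
  have hreach : TransGen G.Next h k :=
    (mem_loop_iff_transGen (mem_loopOf h)).1 (hh ▸ mem_loopOf ⟨k, hk⟩)
  clear hh
  induction hreach with
  | single hn => rw [← hf h, next_eq hn h.2]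
  | tail _ hn ih =>
    have hb := (mem_lines_iff_of_next hn).2 hk
    rw [ih hb, ← hf, next_eq hn hb]

theorem isTarget_iff : G.IsTarget H.lines h ↔ h ∈ H.lines := by
  constructor
  · rintro ⟨k, hk, hn⟩
    exact (mem_lines_iff_of_next hn).1 hk
  · intro hh
    obtain ⟨k, hn⟩ := exists_prev ⟨h, hh⟩
    exact ⟨k, k.2, hn⟩

theorem mem_vertices_iff {v : V} : v ∈ G.vertices H.lines ↔ ∃ s : Bool, (v, s) ∈ H.lines := by
  simp [vertices, isTarget_iff]

theorem mem_vertices_of_mem_lines (hh : h ∈ H.lines) : h.1 ∈ G.vertices H.lines :=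
  mem_vertices_iff.2 ⟨h.2, hh⟩

theorem mem_lines_or_opposite_mem_lines (hh : h.1 ∈ G.vertices H.lines) :
    h ∈ H.lines ∨ (h.1, !h.2) ∈ H.lines := by
  obtain ⟨s, hs⟩ := mem_vertices_iff.1 hh
  obtain rfl | hs' := Bool.eq_or_eq_not s h.2
  · exact Or.inl hs
  · exact Or.inr (hs' ▸ hs)

theorem joins_of_mem (hA : h ∈ A.1) (hB : (h.1, !h.2) ∈ B.1) : H.Joins h.1 A B := by
  obtain ⟨v, _ | _⟩ := h
  · exact Or.inl ⟨hA, hB⟩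
  · exact Or.inr ⟨hA, hB⟩

theorem eq_or_joins_of_strand {c : Fin 6} (hA : h ∈ A.1) (hB : G.strand c h ∈ B.1) :
    A = B ∨ G.color h.1 = c ∧ H.Joins h.1 A B := by
  obtain rfl | hc := eq_or_ne c (G.color h.1)
  · exact Or.inr ⟨rfl, joins_of_mem hA (strand_color (G := G) h ▸ hB)⟩
  · exact Or.inl (loop_unique hA (strand_of_ne hc ▸ hB))

end Loops

section Counting

variable (H)

/-- The wavy lines with both ends on loop vertices of `H`. -/
def internalWavy : Set V := {v | (v, false) ∈ H.lines ∧ (v, true) ∈ H.lines}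

/-- The ends, not on `H`, of the external wavy lines. -/
def freeEnds : Set (HalfWavy V) := {h | h.1 ∈ G.vertices H.lines ∧ h ∉ H.lines}

theorem mem_internalWavy_iff (h : HalfWavy V) :
    h.1 ∈ H.internalWavy ↔ h ∈ H.lines ∧ (h.1, !h.2) ∈ H.lines := by
  obtain ⟨v, _ | _⟩ := h
  · rfl
  · exact and_comm

theorem mem_freeEnds_iff : h ∈ H.freeEnds ↔ (h.1, !h.2) ∈ H.externalWavy := by
  constructor
  · exact fun hh => ⟨(mem_lines_or_opposite_mem_lines hh.1).resolve_left hh.2, by simpa using hh.2⟩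
  · exact fun hh => ⟨mem_vertices_of_mem_lines (h := (h.1, !h.2)) hh.1, by simpa using hh.2⟩

theorem card_lines [Finite V] :
    Nat.card H.lines = 2 * Nat.card H.internalWavy + H.numExternalWavy := by
  have hinternal : H.lines ∩ {h | (h.1, !h.2) ∈ H.lines} = H.internalWavy ×ˢ Set.univ :=
    Set.ext fun h => by simp [mem_internalWavy_iff]
  have hexternal : H.lines \ {h | (h.1, !h.2) ∈ H.lines} = H.externalWavy := rfl
  rw [numExternalWavy, Nat.card_coe_set_eq, Nat.card_coe_set_eq, Nat.card_coe_set_eq,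
    ← Set.ncard_inter_add_ncard_sdiff_eq_ncard H.lines {h | (h.1, !h.2) ∈ H.lines},
    hinternal, hexternal, Set.ncard_prod, Set.ncard_univ, Nat.card_eq_fintype_card,
    Fintype.card_bool, mul_comm]

theorem card_freeEnds : Nat.card H.freeEnds = H.numExternalWavy := by
  let opposite : Equiv.Perm (HalfWavy V) := (Equiv.refl V).prodCongr Equiv.boolNot
  exact Nat.card_congr (opposite.subtypeEquiv fun h => H.mem_freeEnds_iff)

theorem numExternalLines_eq : G.numExternalLines H.lines = 2 * H.numExternalWavy := by
  simp only [numExternalLines, isTarget_iff, two_mul]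
  exact congrArg₂ _ H.card_freeEnds H.card_freeEnds

open Classical in
/-- The ends at the vertices of `H` are those on `H` and the free ones. -/
noncomputable def linesSumFreeEnds : H.lines ⊕ H.freeEnds ≃ G.Ends H.lines where
  toFun := Sum.elim (fun h => ⟨h.1, mem_vertices_of_mem_lines h.2⟩) fun h => ⟨h.1, h.2.1⟩
  invFun h := if hh : h.1 ∈ H.lines then Sum.inl ⟨h.1, hh⟩ else Sum.inr ⟨h.1, h.2, hh⟩
  left_inv := by rintro (⟨h, hh⟩ | ⟨h, hv, hh⟩) <;> simp [hh]
  right_inv h := by by_cases hh : h.1 ∈ H.lines <;> simp [hh]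

theorem card_vertices [Finite V] :
    Nat.card (G.vertices H.lines) = Nat.card H.internalWavy + H.numExternalWavy := by
  have hends := Nat.card_congr (H.linesSumFreeEnds.trans (G.endsEquiv H.lines).symm)
  rw [Nat.card_sum, Nat.card_prod, H.card_lines, H.card_freeEnds,
    Nat.card_eq_fintype_card (α := Bool), Fintype.card_bool] at hends
  omega

end Counting

section Kernel

variable (H) in
/-- The functions of a colour and a loop vertex that sum to zero over the colours, agree at the two
ends of an internal wavy line for its colour, and vanish at an external wavy line for its colour.
A function on the internal faces in the kernel of the incidence matrix is constant along the arcs of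
a loop vertex, and this is what remains of it. -/
def loopSpace : Submodule ℚ (Fin 6 → H.loops → ℚ) where
  carrier := {u | (∀ A, ∑ c, u c A = 0) ∧
    (∀ v A B, H.Joins v A B → u (G.color v) A = u (G.color v) B) ∧
    ∀ h ∈ H.externalWavy, ∀ A : H.loops, h ∈ A.1 → u (G.color h.1) A = 0}
  zero_mem' := by simp
  add_mem' := by
    rintro u w ⟨hu₁, hu₂, hu₃⟩ ⟨hw₁, hw₂, hw₃⟩
    refine ⟨fun A => ?_, fun v A B hv => ?_, fun h hh A hA => ?_⟩
    · simp [Finset.sum_add_distrib, hu₁, hw₁]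
    · simp [hu₂ v A B hv, hw₂ v A B hv]
    · simp [hu₃ h hh A hA, hw₃ h hh A hA]
  smul_mem' := by
    rintro a u ⟨hu₁, hu₂, hu₃⟩
    refine ⟨fun A => ?_, fun v A B hv => ?_, fun h hh A hA => ?_⟩
    · simp [← Finset.mul_sum, hu₁]
    · simp [hu₂ v A B hv]
    · simp [hu₃ h hh A hA]

theorem eq_of_mem_loop {α : Type*} {g : HalfWavy V → α}
    (hg : ∀ h ∈ H.lines, ∀ h', G.Next h h' → g h' = g h) (hA : h ∈ A.1) (hA' : h' ∈ A.1) :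
    g h = g h' :=
  eq_of_loopOf_eq (f := fun l : H.lines => g l) (fun l => hg l l.2 _ (next_spec l))
    ((loopOf_eq hA).trans (loopOf_eq hA').symm)

section ToLoopSpace

variable [Finite V] {y : G.InternalFace H.lines → ℚ}

theorem sum_extendZero_eq_zero (hy : y ∈ (G.incidence H.lines).mulVecLin.ker)
    (hh : h ∈ H.lines) : ∑ c, extendZero y ⟨c, G.faceAt H.lines c (Sum.inl h)⟩ = 0 :=
  (incidence_mulVecLin_apply y ⟨h, hh⟩).symm.trans (congrFun hy ⟨h, hh⟩)

/-- The arc from `h` to `h'` and the next one share the faces of all colours but that of the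
wavy line which they meet, and the sum over all colours vanishes on both. -/
theorem extendZero_next (hy : y ∈ (G.incidence H.lines).mulVecLin.ker) (hh : h ∈ H.lines)
    (hn : G.Next h h') (c : Fin 6) :
    extendZero y ⟨c, G.faceAt H.lines c (Sum.inl h')⟩ =
      extendZero y ⟨c, G.faceAt H.lines c (Sum.inl h)⟩ := by
  have hne (c : Fin 6) (hc : c ≠ G.color h'.1) :
      extendZero y ⟨c, G.faceAt H.lines c (Sum.inl h')⟩ =
        extendZero y ⟨c, G.faceAt H.lines c (Sum.inl h)⟩ := by
    rw [faceAt_line c hh hn, faceAt_strand c h', strand_of_ne hc]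
  obtain rfl | hc := eq_or_ne c (G.color h'.1)
  · have hsum := sum_extendZero_eq_zero hy hh
    have hsum' := sum_extendZero_eq_zero hy ((mem_lines_iff_of_next hn).1 hh)
    rw [← Finset.add_sum_erase _ _ (Finset.mem_univ (G.color h'.1))] at hsum hsum'
    rw [Finset.sum_congr rfl fun d hd => hne d (Finset.ne_of_mem_erase hd)] at hsum'
    linear_combination hsum' - hsum
  · exact hne c hc

theorem extendZero_eq_of_mem_loop (hy : y ∈ (G.incidence H.lines).mulVecLin.ker) (hA : h ∈ A.1)
    (hA' : h' ∈ A.1) (c : Fin 6) :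
    extendZero y ⟨c, G.faceAt H.lines c (Sum.inl h)⟩ =
      extendZero y ⟨c, G.faceAt H.lines c (Sum.inl h')⟩ :=
  eq_of_mem_loop (g := fun h => extendZero y ⟨c, G.faceAt H.lines c (Sum.inl h)⟩)
    (fun _ hh _ hn => extendZero_next hy hh hn c) hA hA'

theorem extendZero_opposite (hy : y ∈ (G.incidence H.lines).mulVecLin.ker) (hh : h ∈ H.lines) :
    extendZero y ⟨G.color h.1, G.faceAt H.lines (G.color h.1) (Sum.inl (h.1, !h.2))⟩ =
      extendZero y ⟨G.color h.1, G.faceAt H.lines (G.color h.1) (Sum.inl h)⟩ := by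
  obtain ⟨k, hn⟩ := exists_prev ⟨h, hh⟩
  rw [extendZero_next hy k.2 hn, faceAt_line _ k.2 hn, faceAt_inr, strand_color]

/-- The value of `y` at a loop vertex, read off at any of its arcs. -/
noncomputable def kerToLoopSpace : (G.incidence H.lines).mulVecLin.ker →ₗ[ℚ] H.loopSpace :=
  LinearMap.codRestrict H.loopSpace
    (LinearMap.pi fun c => LinearMap.pi fun A =>
      LinearMap.proj ⟨c, G.faceAt H.lines c (Sum.inl (loop_nonempty A).choose)⟩ ∘ₗ
        extendZero ∘ₗ Submodule.subtype _) <| by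
    intro y
    have hvalue {A : H.loops} {h : HalfWavy V} (hA : h ∈ A.1) (c : Fin 6) :=
      extendZero_eq_of_mem_loop y.2 (loop_nonempty A).choose_spec hA c
    have hopp {A B : H.loops} {h : HalfWavy V} (hA : h ∈ A.1) (hB : (h.1, !h.2) ∈ B.1) :=
      ((hvalue hB _).trans (extendZero_opposite y.2 (mem_lines_of_mem_loop hA))).trans
        (hvalue hA _).symm
    have hsum (A : H.loops) :=
      sum_extendZero_eq_zero y.2 (mem_lines_of_mem_loop (loop_nonempty A).choose_spec)
    refine ⟨hsum, ?_, fun h hh A hA => (hvalue hA _).trans ?_⟩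
    · rintro v A B (⟨hA, hB⟩ | ⟨hA, hB⟩)
      · exact (hopp hA hB).symm
      · exact (hopp hA hB).symm
    · rw [faceAt_strand, strand_color]
      exact extendZero_of_not_onLine _ _ (mt isTarget_iff.1 hh.2)

theorem kerToLoopSpace_apply (y : (G.incidence H.lines).mulVecLin.ker) (hA : h ∈ A.1) (c : Fin 6) :
    (kerToLoopSpace y).1 c A = extendZero y.1 ⟨c, G.faceAt H.lines c (Sum.inl h)⟩ :=
  extendZero_eq_of_mem_loop y.2 (loop_nonempty A).choose_spec hA c

theorem kerToLoopSpace_injective :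
    Function.Injective (kerToLoopSpace : (G.incidence H.lines).mulVecLin.ker →ₗ[ℚ] _) := by
  refine (injective_iff_map_eq_zero _).2 fun y hy => Subtype.ext (funext fun f => ?_)
  obtain ⟨h, hh, hf⟩ : ∃ h ∈ H.lines, G.faceAt H.lines f.1 (Sum.inl h) = f.2.1 := by
    obtain ⟨c, ⟨⟨h | h⟩, hf⟩⟩ := f
    · exact ⟨h, hf _ rfl, rfl⟩
    · obtain ⟨k, hn⟩ := exists_prev ⟨h, isTarget_iff.1 (hf _ rfl)⟩
      exact ⟨k, k.2, faceAt_line c k.2 hn⟩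
  have hzero := kerToLoopSpace_apply y (mem_loopOf ⟨h, hh⟩) f.1
  rw [hy, hf] at hzero
  exact (extendZero_toFace y.1 f).symm.trans hzero.symm

end ToLoopSpace

section OfLoopSpace

/-- The function on the ends that is constant on each loop vertex, extended by zero to the ends
which are not on `H`. -/
noncomputable def extendLoops (u : H.loops → ℚ) : HalfWavy V → ℚ :=
  Function.extend Subtype.val (u ∘ H.loopOf) 0

theorem extendLoops_of_mem_loop (u : H.loops → ℚ) (hA : h ∈ A.1) : extendLoops u h = u A := by
  rw [← loopOf_eq hA]
  exact Subtype.val_injective.extend_apply _ _ (⟨h, mem_lines_of_mem_loop hA⟩ : H.lines)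

theorem extendLoops_of_notMem (u : H.loops → ℚ) (hh : h ∉ H.lines) : extendLoops u h = 0 :=
  Function.extend_apply' _ _ _ fun ⟨l, hl⟩ => hh (hl ▸ l.2)

theorem extendLoops_next (u : H.loops → ℚ) (hh : h ∈ H.lines) (hn : G.Next h h') :
    extendLoops u h = extendLoops u h' := by
  rw [extendLoops_of_mem_loop u (mem_loopOf ⟨h, hh⟩),
    extendLoops_of_mem_loop u ((mem_loop_iff_of_next hn).1 (mem_loopOf ⟨h, hh⟩))]

theorem extendLoops_opposite {u : Fin 6 → H.loops → ℚ} (hu : u ∈ H.loopSpace) (h : HalfWavy V) :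
    extendLoops (u (G.color h.1)) (h.1, !h.2) = extendLoops (u (G.color h.1)) h := by
  by_cases hh : h ∈ H.lines <;> by_cases hh' : (h.1, !h.2) ∈ H.lines
  · rw [extendLoops_of_mem_loop _ (mem_loopOf ⟨_, hh⟩),
      extendLoops_of_mem_loop _ (mem_loopOf ⟨_, hh'⟩)]
    exact (hu.2.1 _ _ _ (joins_of_mem (mem_loopOf ⟨_, hh⟩) (mem_loopOf ⟨_, hh'⟩))).symm
  · rw [extendLoops_of_mem_loop _ (mem_loopOf ⟨_, hh⟩), extendLoops_of_notMem _ hh']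
    exact (hu.2.2 h ⟨hh, hh'⟩ _ (mem_loopOf ⟨_, hh⟩)).symm
  · rw [extendLoops_of_mem_loop _ (mem_loopOf ⟨_, hh'⟩), extendLoops_of_notMem _ hh]
    exact hu.2.2 (h.1, !h.2) ⟨hh', by simpa using hh⟩ _ (mem_loopOf ⟨_, hh'⟩)
  · rw [extendLoops_of_notMem _ hh, extendLoops_of_notMem _ hh']

theorem extendLoops_strand {u : Fin 6 → H.loops → ℚ} (hu : u ∈ H.loopSpace) (c : Fin 6)
    (h : HalfWavy V) : extendLoops (u c) (G.strand c h) = extendLoops (u c) h := by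
  obtain rfl | hc := eq_or_ne c (G.color h.1)
  · rw [strand_color, extendLoops_opposite hu]
  · rw [strand_of_ne hc]

theorem kerToLoopSpace_surjective [Finite V] :
    Function.Surjective (kerToLoopSpace : (G.incidence H.lines).mulVecLin.ker →ₗ[ℚ] _) := by
  intro u
  let g : (Σ c, G.Face H.lines c) → ℚ := fun f => liftFace (extendLoops (u.1 f.1)) f.1
    (fun _ hh _ hn => extendLoops_next _ hh hn) (extendLoops_strand u.2 f.1) f.2
  have hg : extendZero (g ∘ toFace) = g := by
    refine extendZero_comp_toFace ?_
    rintro c (h | h) hh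
    · exact extendLoops_of_notMem _ hh
    · exact extendLoops_of_notMem _ (mt isTarget_iff.2 hh)
  have hvalue (c : Fin 6) {A : H.loops} {h : HalfWavy V} (hA : h ∈ A.1) :
      extendZero (g ∘ toFace) ⟨c, G.faceAt H.lines c (Sum.inl h)⟩ = u.1 c A :=
    (congrFun hg _).trans (extendLoops_of_mem_loop _ hA)
  have hker : g ∘ toFace ∈ (G.incidence H.lines).mulVecLin.ker := by
    refine funext fun l => (incidence_mulVecLin_apply _ l).trans ?_
    simpa only [hvalue _ (mem_loopOf l), Pi.zero_apply] using u.2.1 (H.loopOf l)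
  refine ⟨⟨_, hker⟩, Subtype.ext (funext₂ fun c A => ?_)⟩
  obtain ⟨h, hA⟩ := loop_nonempty A
  rw [kerToLoopSpace_apply _ hA, hvalue c hA]

end OfLoopSpace

theorem omega_eq [Finite V] : H.omega =
    Module.finrank ℚ H.loopSpace - 4 * (Nat.card H.internalWavy : ℤ) - 2 * H.numExternalWavy := by
  rw [omega, divergenceDegree_eq, card_lines, (LinearEquiv.ofBijective kerToLoopSpace
    ⟨kerToLoopSpace_injective, kerToLoopSpace_surjective⟩).finrank_eq]
  push_cast
  ring

end Kernel

section Trees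

variable (H) in
/-- The loop vertices that bear the two ends of an internal wavy line. -/
noncomputable def wavyEnds (v : H.internalWavy) : Sym2 H.loops :=
  s(H.loopOf ⟨(v, false), v.2.1⟩, H.loopOf ⟨(v, true), v.2.2⟩)

theorem wavyEnds_eq_iff {v : H.internalWavy} : H.wavyEnds v = s(A, B) ↔ H.Joins v A B := by
  have hloop (h : H.lines) (C : H.loops) : H.loopOf h = C ↔ h.1 ∈ C.1 :=
    ⟨fun hC => hC ▸ mem_loopOf h, loopOf_eq⟩
  simp only [wavyEnds, Sym2.eq_iff, hloop, Joins]
  tauto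

theorem mem_internalWavy_of_joins {v : V} (hv : H.Joins v A B) : v ∈ H.internalWavy := by
  rcases hv with ⟨hA, hB⟩ | ⟨hA, hB⟩
  · exact ⟨mem_lines_of_mem_loop hA, mem_lines_of_mem_loop hB⟩
  · exact ⟨mem_lines_of_mem_loop hB, mem_lines_of_mem_loop hA⟩

theorem exists_joins_iff : (∃ v, H.Joins v A B) ↔ s(A, B) ∈ Set.range H.wavyEnds := by
  constructor
  · exact fun ⟨v, hv⟩ => ⟨⟨v, mem_internalWavy_of_joins hv⟩, wavyEnds_eq_iff.2 hv⟩
  · exact fun ⟨v, hv⟩ => ⟨v, wavyEnds_eq_iff.1 hv⟩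

theorem simpleGraph_eq : H.simpleGraph = SimpleGraph.fromEdgeSet (Set.range H.wavyEnds) := by
  ext A B
  rw [SimpleGraph.fromEdgeSet_adj, ← exists_joins_iff]
  exact and_comm

theorem isTree_iff_wavyEnds : H.IsTree ↔ H.simpleGraph.IsTree ∧
    Function.Injective H.wavyEnds ∧ ∀ v, ¬ (H.wavyEnds v).IsDiag := by
  have hdiag : (∀ v A, ¬ H.Joins v A A) ↔ ∀ v, ¬ (H.wavyEnds v).IsDiag := by
    constructor
    · intro hself v hv
      exact hself v _ (wavyEnds_eq_iff.1 (Sym2.diag_diagElem hv).symm)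
    · intro hdiag v A hv
      refine hdiag ⟨v, mem_internalWavy_of_joins hv⟩ ?_
      rw [wavyEnds_eq_iff.2 hv]
      exact Sym2.diag_isDiag A
  have hinj : (∀ v w A B, H.Joins v A B → H.Joins w A B → v = w) ↔
      Function.Injective H.wavyEnds := by
    constructor
    · refine fun hpair v w hvw => Subtype.ext (hpair v w _ _ (wavyEnds_eq_iff.1 rfl) ?_)
      exact wavyEnds_eq_iff.1 hvw.symm
    · exact fun hinj v w A B hv hw => congrArg Subtype.val
        (@hinj ⟨v, mem_internalWavy_of_joins hv⟩ ⟨w, mem_internalWavy_of_joins hw⟩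
          ((wavyEnds_eq_iff.2 hv).trans (wavyEnds_eq_iff.2 hw).symm))
  rw [IsTree, hdiag, hinj, and_comm (a := ∀ v, _)]

theorem card_loops_le [Finite V] (hc : H.Connected) :
    Nat.card H.loops ≤ Nat.card H.internalWavy + 1 :=
  card_le_of_connected_fromEdgeSet_range (f := H.wavyEnds) (by rwa [← simpleGraph_eq])

theorem isTree_iff [Finite V] :
    H.IsTree ↔ H.Connected ∧ Nat.card H.internalWavy + 1 = Nat.card H.loops := by
  rw [isTree_iff_wavyEnds, Connected, simpleGraph_eq, isTree_fromEdgeSet_range_iff]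

end Trees

section ColorComponents

variable (H) in
/-- The connected components of the loop vertices of `H` for the wavy lines of colour `c`. They
correspond to the faces of colour `c` on a tree. -/
def ColorComponent (c : Fin 6) : Type _ :=
  Quot fun A B : H.loops => ∃ v, H.Joins v A B ∧ G.color v = c

/-- The component of a loop vertex for the wavy lines of colour `c`. -/
def colorComponent (c : Fin 6) (A : H.loops) : H.ColorComponent c := Quot.mk _ A

theorem colorComponent_eq_of_joins {v : V} (hv : H.Joins v A B) (hc : G.color v = c) :
    colorComponent c A = colorComponent c B :=
  Quot.sound ⟨v, hv, hc⟩

theorem eq_of_colorComponent_eq {α : Type*} {u : H.loops → α}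
    (hu : ∀ v A B, H.Joins v A B → G.color v = c → u A = u B)
    (hAB : colorComponent c A = colorComponent c B) : u A = u B :=
  congrArg (Quot.lift u fun _ _ ⟨v, hv, hc⟩ => hu v _ _ hv hc) hAB

theorem colorComponent_eq_of_faceAt_eq (hA : h ∈ A.1) (hB : h' ∈ B.1)
    (hf : G.faceAt H.lines c (Sum.inl h) = G.faceAt H.lines c (Sum.inr h')) :
    colorComponent c A = colorComponent c B := by
  let near (h : HalfWavy V) : Prop :=
    ∃ B : H.loops, colorComponent c A = colorComponent c B ∧ (h ∈ B.1 ∨ G.strand c h ∈ B.1)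
  have hmem {h : HalfWavy V} {B : H.loops} (hB : h ∈ B.1) :
      near h ↔ colorComponent c A = colorComponent c B := by
    refine ⟨?_, fun hAB => ⟨B, hAB, Or.inl hB⟩⟩
    rintro ⟨C, hAC, hC | hC⟩
    · rwa [loop_unique hB hC]
    · obtain rfl | ⟨hc, hv⟩ := eq_or_joins_of_strand hB hC
      · exact hAC
      · exact hAC.trans (colorComponent_eq_of_joins hv hc).symm
  have hline (h) (hh : h ∈ H.lines) (h') (hn : G.Next h h') : near h = near h' := by
    obtain ⟨B, hBH, hB⟩ := hh
    exact propext ((hmem (B := ⟨B, hBH⟩) hB).trans (hmem ((mem_loop_iff_of_next hn).1 hB)).symm)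
  have hstrand (h : HalfWavy V) : near (G.strand c h) = near h := by
    simp only [near, strand_strand, or_comm]
  have hnear : near h = near h' := congrArg (liftFace near c hline hstrand) hf
  exact (hmem hB).1 (hnear ▸ (hmem hA).2 rfl)

theorem SameStrand.colorComponent_eq (hs : H.SameStrand h h') (hA : h ∈ A.1) (hB : h' ∈ B.1) :
    colorComponent (G.color h.1) A = colorComponent (G.color h.1) B := by
  rcases hs.2 with hf | hf
  · exact colorComponent_eq_of_faceAt_eq hA hB hf
  · exact (colorComponent_eq_of_faceAt_eq hB hA hf).symm

end ColorComponents

section UpperBound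

/-- With `A₀` as the root, `c` is the colour of a wavy line from `A` to a loop vertex which is
closer to the root or, at the root itself, the colour of the wavy line `h₀`. -/
def IsParentColor (h₀ : HalfWavy V) (A₀ A : H.loops) (c : Fin 6) : Prop :=
  (A = A₀ ∧ c = G.color h₀.1) ∨ ∃ B v, H.Joins v A B ∧
    H.simpleGraph.dist B A₀ < H.simpleGraph.dist A A₀ ∧ c = G.color v

theorem exists_isParentColor (hconn : H.Connected) (h₀ : HalfWavy V) (A₀ A : H.loops) :
    ∃ c, IsParentColor h₀ A₀ A c := by
  by_cases hA : A = A₀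
  · exact ⟨_, Or.inl ⟨hA, rfl⟩⟩
  · obtain ⟨B, ⟨-, v, hv⟩, hlt⟩ := exists_adj_dist_lt hconn hA
    exact ⟨_, Or.inr ⟨B, v, hv, hlt, rfl⟩⟩

theorem IsParentColor.apply_eq_zero (hc : IsParentColor h₀ A₀ A c) (hh₀ : h₀ ∈ H.externalWavy)
    (hA₀ : h₀ ∈ A₀.1) {u : Fin 6 → H.loops → ℚ} (hu : u ∈ H.loopSpace)
    (hcloser : ∀ B, H.simpleGraph.dist B A₀ < H.simpleGraph.dist A A₀ → ∀ c, u c B = 0) :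
    u c A = 0 := by
  rcases hc with ⟨rfl, rfl⟩ | ⟨B, v, hv, hlt, rfl⟩
  · exact hu.2.2 h₀ hh₀ A hA₀
  · rw [hu.2.1 v A B hv, hcloser B hlt]

theorem finrank_loopSpace_le [Finite V] (hconn : H.Connected) (hext : H.externalWavy.Nonempty) :
    Module.finrank ℚ H.loopSpace ≤ 4 * Nat.card H.loops := by
  have := Fintype.ofFinite H.loops
  obtain ⟨h₀, hh₀⟩ := hext
  choose pc hpc using exists_isParentColor hconn h₀ (H.loopOf ⟨h₀, hh₀.1⟩)
  have hle := finrank_add_sum_card_le (W := H.loopSpace) (fun u hu => hu.1) _ (fun A => {pc A})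
    (by simp) fun u hu A hcloser c hc => by
      rw [Finset.mem_singleton.1 hc]
      exact (hpc A).apply_eq_zero hh₀ (mem_loopOf _) hu hcloser
  simp only [Finset.card_singleton, Finset.sum_const, Finset.card_univ, smul_eq_mul,
    Fintype.card_fin] at hle
  rw [Nat.card_eq_fintype_card]
  omega

theorem eq_parentColor_of_apply_eq_zero [Finite V] (hh₀ : h₀ ∈ H.externalWavy) (hA₀ : h₀ ∈ A₀.1)
    {pc : H.loops → Fin 6} (hpc : ∀ A, IsParentColor h₀ A₀ A (pc A))
    (hdim : 4 * Nat.card H.loops ≤ Module.finrank ℚ H.loopSpace)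
    (hzero : ∀ u ∈ H.loopSpace, u c B = 0) : c = pc B := by
  classical
  have := Fintype.ofFinite H.loops
  by_contra hne
  have hcard (A : H.loops) :
      (if A = B then {c, pc B} else {pc A} : Finset (Fin 6)).card = if A = B then 2 else 1 := by
    split_ifs
    · exact Finset.card_pair hne
    · exact Finset.card_singleton _
  have hle := finrank_add_sum_card_le (W := H.loopSpace) (fun u hu => hu.1) _
    (fun A => if A = B then {c, pc B} else {pc A})
    (fun A => by rw [hcard]; split_ifs <;> simp) fun u hu A hcloser d hd => by
      have hparent := (hpc A).apply_eq_zero hh₀ hA₀ hu hcloser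
      split_ifs at hd with hAB
      · subst hAB
        rcases Finset.mem_insert.1 hd with rfl | hd
        · exact hzero u hu
        · rwa [Finset.mem_singleton.1 hd]
      · rwa [Finset.mem_singleton.1 hd]
  have hsum : ∑ A : H.loops, ((if A = B then 2 else 1) + 1) = 2 * Fintype.card H.loops + 1 := by
    have hsplit (A : H.loops) : (if A = B then 2 else 1) + 1 = 2 + if A = B then 1 else 0 := by
      split_ifs <;> rfl
    simp [hsplit, Finset.sum_add_distrib, mul_comm]
  simp only [hcard, hsum, Fintype.card_fin] at hle
  rw [Nat.card_eq_fintype_card] at hdim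
  omega

/-- The value of a colour at a loop vertex is forced to vanish only by a path of wavy lines of that
colour to the external wavy line `h₀`: any other constraint would cost one more dimension. -/
theorem colorComponent_eq_of_apply_eq_zero [Finite V] (hconn : H.Connected)
    (hh₀ : h₀ ∈ H.externalWavy) (hA₀ : h₀ ∈ A₀.1)
    (hdim : 4 * Nat.card H.loops ≤ Module.finrank ℚ H.loopSpace)
    (hzero : ∀ u ∈ H.loopSpace, u c A = 0) :
    c = G.color h₀.1 ∧ colorComponent c A = colorComponent c A₀ := by
  choose pc hpc using exists_isParentColor hconn h₀ A₀
  induction hn : H.simpleGraph.dist A A₀ using Nat.strong_induction_on generalizing A with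
  | _ n ih =>
    have hc := eq_parentColor_of_apply_eq_zero hh₀ hA₀ hpc hdim hzero
    rcases hpc A with ⟨rfl, hparent⟩ | ⟨B, v, hv, hlt, hparent⟩
    · exact ⟨hc.trans hparent, rfl⟩
    · obtain rfl := hc.trans hparent
      obtain ⟨hc₀, hB⟩ := ih _ (hn ▸ hlt)
        (fun u hu => (hu.2.1 v A B hv).symm.trans (hzero u hu)) rfl
      exact ⟨hc₀, (colorComponent_eq_of_joins hv rfl).trans hB⟩

end UpperBound

section LowerBound

/-- The map whose kernel is the loop space when all external wavy lines have the colour `c` and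
are connected to `A₀` by wavy lines of this colour. -/
noncomputable def constraints (c : Fin 6) (A₀ : H.loops) :
    (Fin 6 → H.loops → ℚ) →ₗ[ℚ] (H.loops → ℚ) × (H.internalWavy → ℚ) × ℚ :=
  let value (c : Fin 6) (A : H.loops) : (Fin 6 → H.loops → ℚ) →ₗ[ℚ] ℚ :=
    LinearMap.proj A ∘ₗ LinearMap.proj c
  (LinearMap.pi fun A => ∑ c, value c A).prod <|
    (LinearMap.pi fun v : H.internalWavy => value (G.color v) (H.loopOf ⟨_, v.2.1⟩) -
      value (G.color v) (H.loopOf ⟨_, v.2.2⟩)).prod (value c A₀)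

theorem ker_constraints_le (hext : ∀ h ∈ H.externalWavy, ∀ A : H.loops, h ∈ A.1 →
    G.color h.1 = c ∧ colorComponent c A₀ = colorComponent c A) :
    LinearMap.ker (constraints c A₀) ≤ H.loopSpace := by
  intro u hu
  obtain ⟨hsum, hdiff, hzero⟩ : (∀ A, ∑ c, u c A = 0) ∧
      (∀ v : H.internalWavy, u (G.color v) (H.loopOf ⟨_, v.2.1⟩) =
        u (G.color v) (H.loopOf ⟨_, v.2.2⟩)) ∧ u c A₀ = 0 := by
    simpa [constraints, Prod.ext_iff, funext_iff, sub_eq_zero] using hu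
  have hends {v : V} {A B : H.loops} (hA : (v, false) ∈ A.1) (hB : (v, true) ∈ B.1) :
      u (G.color v) A = u (G.color v) B := by
    have hv := hdiff ⟨v, mem_lines_of_mem_loop hA, mem_lines_of_mem_loop hB⟩
    rwa [loopOf_eq hA, loopOf_eq hB] at hv
  have hjoins : ∀ v A B, H.Joins v A B → u (G.color v) A = u (G.color v) B := by
    rintro v A B (⟨hA, hB⟩ | ⟨hA, hB⟩)
    · exact hends hA hB
    · exact (hends hB hA).symm
  refine ⟨hsum, hjoins, fun h hh A hA => ?_⟩
  obtain ⟨rfl, hconn⟩ := hext h hh A hA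
  have huA := eq_of_colorComponent_eq (c := G.color h.1) (u := u (G.color h.1))
    (fun v A B hv hc => hc ▸ hjoins v A B hv) hconn
  rw [← huA, hzero]

theorem le_finrank_loopSpace [Finite V] (ht : H.IsTree) (hext : ∀ h ∈ H.externalWavy,
    ∀ A : H.loops, h ∈ A.1 → G.color h.1 = c ∧ colorComponent c A₀ = colorComponent c A) :
    4 * Nat.card H.loops ≤ Module.finrank ℚ H.loopSpace := by
  have := Fintype.ofFinite H.loops
  have := Fintype.ofFinite H.internalWavy
  have hdim := LinearMap.finrank_range_add_finrank_ker (constraints c A₀)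
  have hrange := Submodule.finrank_le (LinearMap.range (constraints c A₀))
  have hker := Submodule.finrank_mono (ker_constraints_le hext)
  have hcard := (isTree_iff.1 ht).2
  rw [Nat.card_eq_fintype_card, Nat.card_eq_fintype_card] at hcard
  simp only [Module.finrank_prod, Module.finrank_fintype_fun_eq_card, Module.finrank_self,
    Module.finrank_pi_fintype, Finset.sum_const, Finset.card_univ, Fintype.card_fin,
    smul_eq_mul] at hdim hrange
  rw [Nat.card_eq_fintype_card]
  omega

end LowerBound

section Closure

variable (H) in
/-- The closure of `H`: the arcs of `H`, and one arc from each free end to itself. -/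
noncomputable def closure : Equiv.Perm (G.Ends H.lines) :=
  H.linesSumFreeEnds.permCongr (Equiv.sumCongr H.next (Equiv.refl _))

theorem closure_linesSumFreeEnds (x : H.lines ⊕ H.freeEnds) :
    H.closure (H.linesSumFreeEnds x) = H.linesSumFreeEnds (x.map H.next id) := by
  simp [closure, Equiv.permCongr_apply]

theorem closure_mem_contraction {h : G.Ends H.lines} (hh : h.1 ∈ H.lines) :
    (H.closure h).1 ∈ G.contraction h.1 :=
  (closure_linesSumFreeEnds (Sum.inl ⟨h.1, hh⟩)) ▸ next_spec ⟨h.1, hh⟩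

/-- The loop vertex of the closure that bears an end. Every free end is a loop vertex. -/
noncomputable def label (h : G.Ends H.lines) : H.loops ⊕ H.freeEnds :=
  (H.linesSumFreeEnds.symm h).map H.loopOf id

theorem label_linesSumFreeEnds (x : H.lines ⊕ H.freeEnds) :
    label (H.linesSumFreeEnds x) = x.map H.loopOf id := by
  rw [label, Equiv.symm_apply_apply]

theorem label_of_mem_loop (hA : h ∈ A.1) (hh : h.1 ∈ G.vertices H.lines) :
    label ⟨h, hh⟩ = Sum.inl A :=
  (label_linesSumFreeEnds (Sum.inl ⟨h, mem_lines_of_mem_loop hA⟩)).trans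
    (congrArg Sum.inl (loopOf_eq hA))

theorem label_closure (h : G.Ends H.lines) : label (H.closure h) = label h := by
  obtain ⟨x, rfl⟩ := H.linesSumFreeEnds.surjective h
  rw [closure_linesSumFreeEnds, label_linesSumFreeEnds, label_linesSumFreeEnds]
  cases x
  · exact congrArg Sum.inl (loopOf_next _)
  · rfl

theorem label_surjective : Function.Surjective (label : G.Ends H.lines → H.loops ⊕ H.freeEnds) :=
  (loopOf_surjective.sumMap Function.surjective_id).comp H.linesSumFreeEnds.symm.surjective

theorem eq_of_label_eq {f : G.Ends H.lines → α} (hf : ∀ h, f (H.closure h) = f h)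
    {h h' : G.Ends H.lines} (hh : label h = label h') : f h = f h' := by
  obtain ⟨x, rfl⟩ := H.linesSumFreeEnds.surjective h
  obtain ⟨y, rfl⟩ := H.linesSumFreeEnds.surjective h'
  rw [label_linesSumFreeEnds, label_linesSumFreeEnds] at hh
  rcases x with x | x <;> rcases y with y | y
  · refine eq_of_loopOf_eq (f := fun l => f (H.linesSumFreeEnds (Sum.inl l))) (fun l => ?_)
      (Sum.inl_injective hh)
    exact (congrArg f (closure_linesSumFreeEnds (Sum.inl l))).symm.trans (hf _)
  · cases hh
  · cases hh
  · rw [show x = y from Sum.inr_injective hh]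

theorem eq_of_label_ends_eq (hconn : H.Connected) {u : H.loops ⊕ H.freeEnds → α}
    (hu : ∀ v, u (label (G.endsEquiv H.lines (v, true))) =
      u (label (G.endsEquiv H.lines (v, false)))) (x y : H.loops ⊕ H.freeEnds) : u x = u y := by
  have hopp : ∀ h (hh : h.1 ∈ G.vertices H.lines),
      u (label ⟨h, hh⟩) = u (label ⟨(h.1, !h.2), hh⟩) := by
    rintro ⟨v, _ | _⟩ hv
    · exact (hu ⟨v, hv⟩).symm
    · exact hu ⟨v, hv⟩
  have hends {h : HalfWavy V} {A B : H.loops} (hA : h ∈ A.1) (hB : (h.1, !h.2) ∈ B.1) :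
      u (Sum.inl A) = u (Sum.inl B) := by
    have hv := mem_vertices_of_mem_lines (mem_lines_of_mem_loop hA)
    rw [← label_of_mem_loop hA hv, hopp, label_of_mem_loop hB]
  have hloops (A B : H.loops) : u (Sum.inl A) = u (Sum.inl B) := by
    obtain ⟨p⟩ := hconn.preconnected A B
    induction p with
    | nil => rfl
    | cons hadj _ ih =>
      obtain ⟨-, v, hv | hv⟩ := hadj
      · exact (hends hv.1 hv.2).trans ih
      · exact (hends hv.1 hv.2).trans ih
  have hfree : ∀ x, ∃ A, u x = u (Sum.inl A) := by
    rintro (A | ⟨h, hh⟩)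
    · exact ⟨A, rfl⟩
    · have hB := mem_loopOf ⟨_, (H.mem_freeEnds_iff.1 hh).1⟩
      refine ⟨H.loopOf ⟨_, (H.mem_freeEnds_iff.1 hh).1⟩, ?_⟩
      rw [← label_of_mem_loop hB hh.1, ← hopp h hh.1]
      exact congrArg u (label_linesSumFreeEnds (Sum.inr ⟨h, hh⟩)).symm
  obtain ⟨A, hA⟩ := hfree x
  obtain ⟨B, hB⟩ := hfree y
  rw [hA, hB, hloops A B]

theorem card_labels [Finite V] (ht : H.IsTree) :
    Nat.card (H.loops ⊕ H.freeEnds) = Nat.card (G.vertices H.lines) + 1 := by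
  rw [Nat.card_sum, card_vertices, card_freeEnds, ← (isTree_iff.1 ht).2]
  ring

theorem edgeDiff_label_surjective [Finite V] (ht : H.IsTree) : Function.Surjective <|
    edgeDiff ℚ (fun v => label (G.endsEquiv H.lines (v, true)))
      fun v => label (G.endsEquiv H.lines (v, false)) :=
  edgeDiff_surjective (fun _ => eq_of_label_ends_eq (isTree_iff.1 ht).1) (card_labels ht)

theorem bubbleEquiv_of_ne {h : G.Ends H.lines} (hc : c ≠ G.color h.1.1) :
    G.bubbleEquiv H.lines c h = h := Subtype.ext (strand_of_ne hc)

theorem bubbleEquiv_endsEquiv (v : G.vertices H.lines) (s : Bool) :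
    G.bubbleEquiv H.lines (G.color v) (G.endsEquiv H.lines (v, s)) =
      G.endsEquiv H.lines (v, !s) :=
  Subtype.ext (strand_color (v.1, s))

theorem sum_bubbleEquiv (b : G.Ends H.lines → ℚ) (c : Fin 6) (v : G.vertices H.lines) :
    ∑ s, b (G.bubbleEquiv H.lines c (G.endsEquiv H.lines (v, s))) =
      ∑ s, b (G.endsEquiv H.lines (v, s)) := by
  obtain rfl | hc := eq_or_ne c (G.color v)
  · simp only [bubbleEquiv_endsEquiv]
    exact Equiv.sum_comp Equiv.boolNot fun s => b (G.endsEquiv H.lines (v, s))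
  · exact Finset.sum_congr rfl fun s _ => congrArg b (bubbleEquiv_of_ne hc)

/-- A function on the faces of colour `c` of the closure takes the values `a` at the fields `φ` and
`b` at the fields `φ̄`. On a tree, the flow `a - b` along the wavy lines vanishes. -/
theorem eq_of_closure_eq_of_bubbleEquiv_eq [Finite V] (ht : H.IsTree) {a b : G.Ends H.lines → ℚ}
    (hclosure : ∀ h, b (H.closure h) = a h) (hstrand : ∀ h, b (G.bubbleEquiv H.lines c h) = a h) :
    a = b :=
  eq_of_conserved_on_edges (G.endsEquiv H.lines) H.closure label_closure
    (edgeDiff_label_surjective ht) hclosure fun v => by simp only [← hstrand, sum_bubbleEquiv]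

end Closure

section OpenFaces

theorem finsum_freeEnds_faceAt [Finite V] (y : G.Face H.lines c → ℚ) :
    ∑ᶠ h ∈ H.freeEnds, y (G.faceAt H.lines c (Sum.inl h)) =
      ∑ᶠ h ∈ H.freeEnds, y (G.faceAt H.lines c (Sum.inr h)) := by
  have := Fintype.ofFinite H.lines
  have := Fintype.ofFinite H.freeEnds
  have := Fintype.ofFinite (G.Ends H.lines)
  have hends : ∑ h : G.Ends H.lines, y (G.faceAt H.lines c (Sum.inl h)) =
      ∑ h : G.Ends H.lines, y (G.faceAt H.lines c (Sum.inr h)) := by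
    rw [← Equiv.sum_comp (G.bubbleEquiv H.lines c)
      fun h : G.Ends H.lines => y (G.faceAt H.lines c (Sum.inr h))]
    exact Finset.sum_congr rfl fun h _ => congrArg y (faceAt_strand c h.1)
  have hlines : ∑ h : H.lines, y (G.faceAt H.lines c (Sum.inl h)) =
      ∑ h : H.lines, y (G.faceAt H.lines c (Sum.inr h)) := by
    rw [← Equiv.sum_comp H.next fun h : H.lines => y (G.faceAt H.lines c (Sum.inr h))]
    exact Finset.sum_congr rfl fun h _ => congrArg y (faceAt_line c h.2 (next_spec h))
  rw [← Equiv.sum_comp H.linesSumFreeEnds, Fintype.sum_sum_type,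
    ← Equiv.sum_comp H.linesSumFreeEnds, Fintype.sum_sum_type] at hends
  simp only [← finsum_set_coe_eq_finsum_mem, finsum_eq_sum_of_fintype]
  exact add_left_cancel (hends.trans (congrArg (· + _) hlines.symm))

theorem faceAt_inl_eq_inr [Finite V] (ht : H.IsTree) {y : G.Face H.lines c → ℚ}
    (hy : ∀ h ∈ H.freeEnds, y (G.faceAt H.lines c (Sum.inl h)) = y (G.faceAt H.lines c (Sum.inr h)))
    (hh : h ∈ H.lines) :
    y (G.faceAt H.lines c (Sum.inl h)) = y (G.faceAt H.lines c (Sum.inr h)) := by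
  have hsides := eq_of_closure_eq_of_bubbleEquiv_eq ht (c := c)
    (a := fun h => y (G.faceAt H.lines c (Sum.inl h)))
    (b := fun h => y (G.faceAt H.lines c (Sum.inr h)))
    (fun h => by
      obtain ⟨k | k, rfl⟩ := H.linesSumFreeEnds.surjective h
      · rw [closure_linesSumFreeEnds]
        exact congrArg y (faceAt_line c k.2 (next_spec k)).symm
      · rw [closure_linesSumFreeEnds]
        exact (hy k k.2).symm)
    fun h => congrArg y (faceAt_strand c h.1).symm
  exact congrFun hsides ⟨h, mem_vertices_of_mem_lines hh⟩

theorem faceAt_eq_of_colorComponent_eq {y : G.Face H.lines c → ℚ}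
    (hy : ∀ h ∈ H.lines, y (G.faceAt H.lines c (Sum.inl h)) = y (G.faceAt H.lines c (Sum.inr h)))
    (hA : h ∈ A.1) (hB : h' ∈ B.1) (hAB : colorComponent c A = colorComponent c B) :
    y (G.faceAt H.lines c (Sum.inl h)) = y (G.faceAt H.lines c (Sum.inl h')) := by
  have hloop {A : H.loops} {h h' : HalfWavy V} (hA : h ∈ A.1) (hA' : h' ∈ A.1) :
      y (G.faceAt H.lines c (Sum.inl h)) = y (G.faceAt H.lines c (Sum.inl h')) := by
    refine eq_of_mem_loop (g := fun h => y (G.faceAt H.lines c (Sum.inl h))) ?_ hA hA'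
    intro h hh h' hn
    rw [hy h' ((mem_lines_iff_of_next hn).1 hh), ← faceAt_line c hh hn]
  have hends {h : HalfWavy V} {A B : H.loops} (hA : h ∈ A.1) (hB : (h.1, !h.2) ∈ B.1)
      (hc : G.color h.1 = c) : y (G.faceAt H.lines c (Sum.inl (loop_nonempty A).choose)) =
        y (G.faceAt H.lines c (Sum.inl (loop_nonempty B).choose)) := by
    rw [hloop (loop_nonempty A).choose_spec hA, hloop (loop_nonempty B).choose_spec hB,
      hy _ (mem_lines_of_mem_loop hB), faceAt_strand]
    subst hc
    rw [strand_color]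
  have hAB' := eq_of_colorComponent_eq
    (u := fun A => y (G.faceAt H.lines c (Sum.inl (loop_nonempty A).choose)))
    (fun v A B hv hc => hv.elim (fun hv => hends hv.1 hv.2 hc) fun hv => hends hv.1 hv.2 hc) hAB
  exact ((hloop hA (loop_nonempty A).choose_spec).trans hAB').trans
    (hloop (loop_nonempty B).choose_spec hB)

theorem freeEnds_eq_pair (hext : H.externalWavy = {h, h'}) :
    H.freeEnds = {(h.1, !h.2), (h'.1, !h'.2)} := by
  ext ⟨v, s⟩
  rw [mem_freeEnds_iff, hext]
  rcases h with ⟨w, t⟩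
  rcases h' with ⟨w', t'⟩
  simp only [Set.mem_insert_iff, Set.mem_singleton_iff, Prod.mk.injEq, Bool.not_eq_eq_eq_not]

theorem faceAt_inl_opposite (hc : G.color h.1 = c) :
    G.faceAt H.lines c (Sum.inl (h.1, !h.2)) = G.faceAt H.lines c (Sum.inr h) := by
  subst hc
  rw [faceAt_strand, ← strand_color, strand_strand]

theorem faceAt_inr_opposite (hc : G.color h.1 = c) :
    G.faceAt H.lines c (Sum.inr (h.1, !h.2)) = G.faceAt H.lines c (Sum.inl h) := by
  subst hc
  rw [faceAt_strand, strand_color]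

/-- If the open face through the `φ` of `h` did not run to `h'`, it would run from `h` back to `h`,
so its indicator would be constant on the fields of the component, which contains `h'`. -/
theorem sameStrand_of_colorComponent_eq [Finite V] (ht : H.IsTree)
    (hext : H.externalWavy = {h, h'}) (hne : h ≠ h') (hc : G.color h.1 = G.color h'.1)
    (hA : h ∈ A.1) (hB : h' ∈ B.1)
    (hAB : colorComponent (G.color h.1) A = colorComponent (G.color h.1) B) :
    H.SameStrand h h' := by
  classical
  set c := G.color h.1
  refine ⟨hc, Or.inl ?_⟩
  by_contra hstrand
  let y : G.Face H.lines c → ℚ := Pi.single (G.faceAt H.lines c (Sum.inl h)) 1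
  have hy : y (G.faceAt H.lines c (Sum.inl h)) = 1 := Pi.single_eq_same _ _
  have hy' : y (G.faceAt H.lines c (Sum.inr h')) = 0 := Pi.single_eq_of_ne (Ne.symm hstrand) _
  have hopp : (h.1, !h.2) ≠ (h'.1, !h'.2) := by
    simpa [Prod.ext_iff] using hne
  have hbalance := finsum_freeEnds_faceAt y
  rw [freeEnds_eq_pair hext, finsum_mem_pair hopp, finsum_mem_pair hopp,
    faceAt_inl_opposite rfl, faceAt_inl_opposite hc.symm, faceAt_inr_opposite rfl,
    faceAt_inr_opposite hc.symm, hy, hy', add_zero] at hbalance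
  have hclosed : y (G.faceAt H.lines c (Sum.inr h)) = 1 ∧
      y (G.faceAt H.lines c (Sum.inl h')) = 0 := by
    simp only [y, Pi.single_apply] at hbalance ⊢
    grind
  have hfree : ∀ k ∈ H.freeEnds,
      y (G.faceAt H.lines c (Sum.inl k)) = y (G.faceAt H.lines c (Sum.inr k)) := by
    rw [freeEnds_eq_pair hext]
    rintro k (rfl | rfl)
    · rw [faceAt_inl_opposite rfl, faceAt_inr_opposite rfl, hy, hclosed.1]
    · rw [faceAt_inl_opposite hc.symm, faceAt_inr_opposite hc.symm, hy', hclosed.2]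
  have hsame := faceAt_eq_of_colorComponent_eq (fun k hk => faceAt_inl_eq_inr ht hfree hk) hA hB hAB
  rw [hy, hclosed.2] at hsame
  exact one_ne_zero hsame

end OpenFaces

section Melonic

variable {s : Set (Option (Fin 6))}

variable (H) in
/-- The closed coloured graph obtained from `H` by joining the two external half-lines of each free
end. -/
noncomputable abbrev closureGraph :
    ColoredGraph (Option (Fin 6)) (G.Ends H.lines) (G.Ends H.lines) :=
  G.closedGraph H.lines H.closure

variable (H c) in
/-- The number of vertices of `H` of special colour `c`. -/
noncomputable def numColor : ℕ := Nat.card {v : G.vertices H.lines // G.color v = c}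

theorem sum_numColor [Finite V] : ∑ c, H.numColor c = Nat.card (G.vertices H.lines) := by
  rw [← Nat.card_congr (Equiv.sigmaFiberEquiv fun v : G.vertices H.lines => G.color v),
    Nat.card_sigma]
  rfl

theorem card_ends : Nat.card (G.Ends H.lines) = 2 * Nat.card (G.vertices H.lines) := by
  rw [← Nat.card_congr (G.endsEquiv H.lines), Nat.card_prod, Nat.card_eq_fintype_card (α := Bool),
    Fintype.card_bool, mul_comm]

theorem quot_inl_eq_closure (hs : none ∈ s) (h : G.Ends H.lines) :
    Quot.mk (H.closureGraph.Adj s) (Sum.inl h) = Quot.mk _ (Sum.inr (H.closure h)) :=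
  Quot.sound ⟨none, hs, h⟩

theorem quot_inl_eq_bubbleEquiv (hs : some c ∈ s) (h : G.Ends H.lines) :
    Quot.mk (H.closureGraph.Adj s) (Sum.inl h) =
      Quot.mk _ (Sum.inr (G.bubbleEquiv H.lines c h)) :=
  Quot.sound ⟨some c, hs, h⟩

theorem quot_inl_eq_inr_of_ne {h : G.Ends H.lines} (hs : some c ∈ s) (hc : c ≠ G.color h.1.1) :
    Quot.mk (H.closureGraph.Adj s) (Sum.inl h) = Quot.mk _ (Sum.inr h) := by
  simpa only [bubbleEquiv_of_ne hc] using quot_inl_eq_bubbleEquiv hs h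

theorem numComponents_closureGraph_eq_card_quot
    (hside : ∀ h, Quot.mk (H.closureGraph.Adj s) (Sum.inl h) = Quot.mk _ (Sum.inr h))
    {Λ : Type*} {ℓ : G.Ends H.lines → Λ} (hℓ : Function.Surjective ℓ)
    (hlabel : ∀ h h', ℓ h = ℓ h' →
      Quot.mk (H.closureGraph.Adj s) (Sum.inl h) = Quot.mk _ (Sum.inl h'))
    (hclosure : none ∈ s → ∀ h, ℓ (H.closure h) = ℓ h) :
    H.closureGraph.numComponents s = Nat.card (Quot fun A B => ∃ v : G.vertices H.lines,
      some (G.color v) ∈ s ∧ A = ℓ (G.endsEquiv H.lines (v, true)) ∧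
        B = ℓ (G.endsEquiv H.lines (v, false))) := by
  refine ColoredGraph.numComponents_eq_card_quot hside hℓ hlabel ?_ ?_
  · intro v hv
    rw [quot_inl_eq_bubbleEquiv hv, bubbleEquiv_endsEquiv, hside]
    rfl
  · rintro (_ | c) ha h
    · exact Or.inl (hclosure ha h)
    · obtain ⟨⟨v, t⟩, rfl⟩ := (G.endsEquiv H.lines).surjective h
      obtain rfl | hc := eq_or_ne c (G.color v)
      · refine Or.inr ⟨v, ha, ?_⟩
        cases t
        · exact Or.inr ⟨rfl, bubbleEquiv_endsEquiv v false⟩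
        · exact Or.inl ⟨rfl, bubbleEquiv_endsEquiv v true⟩
      · exact Or.inl (congrArg ℓ (bubbleEquiv_of_ne hc))

section Tree

variable [Finite V]

theorem numComponents_closureGraph_add_card (ht : H.IsTree) (hs : none ∈ s)
    (hside : ∀ h, Quot.mk (H.closureGraph.Adj s) (Sum.inl h) = Quot.mk _ (Sum.inr h)) :
    H.closureGraph.numComponents s +
        Nat.card {v : G.vertices H.lines // some (G.color v) ∈ s} =
      Nat.card (G.vertices H.lines) + 1 := by
  rw [numComponents_closureGraph_eq_card_quot hside label_surjective
    (fun _ _ => eq_of_label_eq (f := fun h => Quot.mk _ (Sum.inl h)) fun h => (hside _).trans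
      (quot_inl_eq_closure hs h).symm)
    fun _ => label_closure,
    card_quot_add_card_of_surjective_edgeDiff (edgeDiff_label_surjective ht), card_labels ht]

theorem quot_inl_eq_inr_of_isTree (ht : H.IsTree) (c : Fin 6) (h : G.Ends H.lines) :
    Quot.mk (H.closureGraph.Adj {none, some c}) (Sum.inl h) = Quot.mk _ (Sum.inr h) := by
  classical
  let y : Quot (H.closureGraph.Adj {none, some c}) → ℚ := Pi.single (Quot.mk _ (Sum.inl h)) 1
  have hsides := eq_of_closure_eq_of_bubbleEquiv_eq ht (c := c)
    (a := fun h => y (Quot.mk _ (Sum.inl h))) (b := fun h => y (Quot.mk _ (Sum.inr h)))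
    (fun h => congrArg y (quot_inl_eq_closure (by simp) h).symm)
    fun h => congrArg y (quot_inl_eq_bubbleEquiv (by simp) h).symm
  by_contra hne
  have hzero := congrFun hsides h
  have hy : y (Quot.mk _ (Sum.inl h)) = 1 := Pi.single_eq_same _ _
  have hy' : y (Quot.mk _ (Sum.inr h)) = 0 := Pi.single_eq_of_ne (Ne.symm hne) _
  exact one_ne_zero (hy.symm.trans (hzero.trans hy'))

theorem numComponents_closureGraph_univ (ht : H.IsTree) :
    H.closureGraph.numComponents Set.univ = 1 := by
  have hside (h : G.Ends H.lines) := quot_inl_eq_inr_of_ne (h := h) (c := G.color h.1.1 + 1)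
    (Set.mem_univ _) (by simp)
  have hcount := numComponents_closureGraph_add_card ht (Set.mem_univ _) hside
  rw [Nat.card_congr (Equiv.subtypeUnivEquiv fun v => Set.mem_univ _)] at hcount
  omega

theorem numComponents_closureGraph_none_some (ht : H.IsTree) (c : Fin 6) :
    H.closureGraph.numComponents {none, some c} + H.numColor c =
      Nat.card (G.vertices H.lines) + 1 := by
  rw [← numComponents_closureGraph_add_card ht (by simp) (quot_inl_eq_inr_of_isTree ht c), numColor]
  simp only [Set.mem_insert_iff, Set.mem_singleton_iff, reduceCtorEq, false_or, Option.some.injEq]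

end Tree

theorem edgeDiff_ends_surjective : Function.Surjective <|
    edgeDiff ℚ (fun v => G.endsEquiv H.lines (v, true))
      fun v => G.endsEquiv H.lines (v, false) := by
  intro y
  refine ⟨fun h => let x := (G.endsEquiv H.lines).symm h; bif x.2 then y x.1 else 0, ?_⟩
  ext v
  simp [edgeDiff_apply]

theorem numComponents_closureGraph_some_some [Finite V] (hcc : c ≠ c') :
    H.closureGraph.numComponents {some c, some c'} + (H.numColor c + H.numColor c') =
      2 * Nat.card (G.vertices H.lines) := by
  classical
  have := Fintype.ofFinite (G.vertices H.lines)
  have hside (h : G.Ends H.lines) :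
      Quot.mk (H.closureGraph.Adj {some c, some c'}) (Sum.inl h) = Quot.mk _ (Sum.inr h) := by
    obtain rfl | hc := eq_or_ne c (G.color h.1.1)
    · exact quot_inl_eq_inr_of_ne (c := c') (by simp) hcc.symm
    · exact quot_inl_eq_inr_of_ne (c := c) (by simp) hc
  have hcard : H.numColor c + H.numColor c' =
      Nat.card {v : G.vertices H.lines // some (G.color v) ∈ ({some c, some c'} : Set _)} := by
    simp only [numColor, Nat.card_eq_fintype_card, Set.mem_insert_iff, Set.mem_singleton_iff,
      Option.some.injEq]
    refine (Fintype.card_subtype_or_disjoint _ _ ?_).symm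
    exact Pi.disjoint_iff.2 fun v => Prop.disjoint_iff.2 fun hv => hcc (hv.1.symm.trans hv.2)
  rw [numComponents_closureGraph_eq_card_quot (ℓ := id) hside Function.surjective_id
    (fun h h' hh => congrArg (fun h => Quot.mk _ (Sum.inl h)) hh) (by simp), hcard,
    ← card_ends]
  exact card_quot_add_card_of_surjective_edgeDiff (edgeDiff_ends_surjective (H := H)) _

theorem degree_closureGraph [Finite V] (ht : H.IsTree) : H.closureGraph.degree = 0 := by
  let w : Option (Fin 6) → ℚ := fun a =>
    a.elim 1 fun c => (Nat.card (G.vertices H.lines) : ℚ) - H.numColor c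
  have hnone (c : Fin 6) :
      (H.closureGraph.numComponents {none, some c} : ℚ) = w none + w (some c) := by
    have hcount := congrArg (Nat.cast (R := ℚ)) (numComponents_closureGraph_none_some ht c)
    push_cast at hcount
    simp only [w, Option.elim]
    linarith
  have hsum : ∑ a, w a = 1 + 5 * Nat.card (G.vertices H.lines) := by
    rw [Fintype.sum_option]
    simp only [w, Option.elim, Finset.sum_sub_distrib, Finset.sum_const, Finset.card_univ,
      Fintype.card_fin]
    rw [← Nat.cast_sum, sum_numColor]
    ring
  refine ColoredGraph.degree_eq_zero (w := w) ?_ ?_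
  · rintro (_ | c) (_ | c') hab
    · exact absurd rfl hab
    · exact hnone c'
    · rw [Set.pair_comm, hnone c, add_comm]
    · have hcount := congrArg (Nat.cast (R := ℚ))
        (numComponents_closureGraph_some_some (H := H) fun h => hab (congrArg some h))
      push_cast at hcount
      simp only [w, Option.elim]
      linarith
  · rw [numComponents_closureGraph_univ ht, hsum, card_ends]
    simp only [Fintype.card_option, Fintype.card_fin]
    push_cast
    ring

theorem isMelonic_of_isTree [Finite V] (ht : H.IsTree) : G.IsMelonic H.lines :=
  ⟨H.closure, fun _ => closure_mem_contraction, degree_closureGraph ht⟩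

end Melonic

section Classification

variable [Finite V]

theorem omega_of_isTree (ht : H.IsTree) : H.omega = Module.finrank ℚ H.loopSpace
    - 4 * (Nat.card H.loops : ℤ) + 4 - 2 * H.numExternalWavy := by
  rw [omega_eq, ← (isTree_iff.1 ht).2]
  push_cast
  ring

theorem omega_of_isTree_of_colorComponent_eq (ht : H.IsTree) (hne : H.externalWavy.Nonempty)
    (hext : ∀ k ∈ H.externalWavy, ∀ B : H.loops, k ∈ B.1 →
      G.color k.1 = c ∧ colorComponent c A = colorComponent c B) :
    H.omega = 4 - 2 * H.numExternalWavy := by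
  have hle := finrank_loopSpace_le (isTree_iff.1 ht).1 hne
  have hge := le_finrank_loopSpace ht hext
  rw [omega_of_isTree ht]
  omega

theorem omega_of_numExternalWavy_eq_one (ht : H.IsTree) (h1 : H.numExternalWavy = 1) :
    H.omega = 2 := by
  obtain ⟨h, hh⟩ := Set.ncard_eq_one.1 ((Nat.card_coe_set_eq _).symm.trans h1)
  have hmem : h ∈ H.externalWavy := hh ▸ Set.mem_singleton h
  rw [omega_of_isTree_of_colorComponent_eq ht ⟨h, hmem⟩ (c := G.color h.1)
    (A := H.loopOf ⟨h, hmem.1⟩), h1]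
  · norm_num
  · rw [hh]
    rintro k rfl B hB
    rw [loopOf_eq hB]
    exact ⟨rfl, rfl⟩

theorem externalWavy_eq_pair (h2 : H.numExternalWavy = 2) (hh : h ∈ H.externalWavy)
    (hh' : h' ∈ H.externalWavy) (hne : h ≠ h') : H.externalWavy = {h, h'} :=
  (Set.eq_of_subset_of_ncard_le (Set.pair_subset hh hh')
    (by rw [Set.ncard_pair hne, ← Nat.card_coe_set_eq]; exact h2.le) (Set.toFinite _)).symm

theorem omega_of_hasMonocolorPair (ht : H.IsTree) (hm : H.HasMonocolorPair) : H.omega = 0 := by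
  obtain ⟨h2, h, hh, h', hh', hne, hs⟩ := hm
  rw [omega_of_isTree_of_colorComponent_eq ht ⟨h, hh⟩ (c := G.color h.1)
    (A := H.loopOf ⟨h, hh.1⟩), h2]
  · norm_num
  · rw [externalWavy_eq_pair h2 hh hh' hne]
    rintro k (rfl | rfl) B hB
    · rw [loopOf_eq hB]
      exact ⟨rfl, rfl⟩
    · exact ⟨hs.1.symm, hs.colorComponent_eq (mem_loopOf ⟨h, hh.1⟩) hB⟩

theorem hasMonocolorPair_of_le_finrank (ht : H.IsTree) (h2 : H.numExternalWavy = 2)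
    (hdim : 4 * Nat.card H.loops ≤ Module.finrank ℚ H.loopSpace) : H.HasMonocolorPair := by
  obtain ⟨h, h', hne, hext⟩ := Set.ncard_eq_two.1 ((Nat.card_coe_set_eq _).symm.trans h2)
  have hh : h ∈ H.externalWavy := hext ▸ Set.mem_insert h _
  have hh' : h' ∈ H.externalWavy := hext ▸ Set.mem_insert_of_mem h rfl
  have hA := mem_loopOf ⟨h, hh.1⟩
  have hA' := mem_loopOf ⟨h', hh'.1⟩
  obtain ⟨hcolor, hcomponent⟩ := colorComponent_eq_of_apply_eq_zero (isTree_iff.1 ht).1 hh hA hdim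
    (fun u hu => hu.2.2 h' hh' _ hA')
  refine ⟨h2, h, hh, h', hh', hne,
    sameStrand_of_colorComponent_eq ht hext hne hcolor.symm hA hA' ?_⟩
  rw [← hcolor, hcomponent]

theorem isTree_and_eq_one_or_hasMonocolorPair (hc : H.Connected)
    (hext : 0 < H.numExternalWavy) (hω : 0 ≤ H.omega) :
    H.IsTree ∧ (H.numExternalWavy = 1 ∨ H.HasMonocolorPair) := by
  have hdim := finrank_loopSpace_le hc (Set.nonempty_coe_sort.1 (Nat.card_pos_iff.1 hext).1)
  have hloops := card_loops_le hc
  rw [omega_eq] at hω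
  have ht : H.IsTree := isTree_iff.2 ⟨hc, by omega⟩
  refine ⟨ht, ?_⟩
  by_cases h1 : H.numExternalWavy = 1
  · exact Or.inl h1
  · exact Or.inr (hasMonocolorPair_of_le_finrank ht (by omega) (by omega))

end Classification

end PISubgraph

end FeynmanGraph

theorem mainTheorem3 {V : Type*} [Finite V] (G : FeynmanGraph V) (H : G.PISubgraph)
    (hconn : H.Connected) (hext : 0 < H.numExternalWavy) :
    (0 ≤ H.omega → G.IsMelonic H.lines ∧
      (G.numExternalLines H.lines = 2 ∨ G.numExternalLines H.lines = 4)) ∧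
    (0 ≤ H.omega ↔ H.IsTree ∧ (H.numExternalWavy = 1 ∨ H.HasMonocolorPair)) ∧
    (H.IsTree → H.numExternalWavy = 1 → G.numExternalLines H.lines = 2 ∧ H.omega = 2) ∧
    (H.IsTree → H.HasMonocolorPair → G.numExternalLines H.lines = 4 ∧ H.omega = 0) := by
  open FeynmanGraph.PISubgraph in
  refine ⟨fun hω => ?_, ⟨isTree_and_eq_one_or_hasMonocolorPair hconn hext, ?_⟩,
    fun ht h1 => ?_, fun ht hm => ?_⟩
  · obtain ⟨ht, h1 | hm⟩ := isTree_and_eq_one_or_hasMonocolorPair hconn hext hω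
    · exact ⟨isMelonic_of_isTree ht, Or.inl (by rw [numExternalLines_eq, h1])⟩
    · exact ⟨isMelonic_of_isTree ht, Or.inr (by rw [numExternalLines_eq, hm.1])⟩
  · rintro ⟨ht, h1 | hm⟩
    · rw [omega_of_numExternalWavy_eq_one ht h1]
      norm_num
    · rw [omega_of_hasMonocolorPair ht hm]
  · exact ⟨by rw [numExternalLines_eq, h1], omega_of_numExternalWavy_eq_one ht h1⟩
  · exact ⟨by rw [numExternalLines_eq, hm.1], omega_of_hasMonocolorPair ht hm⟩
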